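/- Let $n \geq 1$ and let $F_n$ be the free group on a fixed basis of $n$ elements, whose elements are identified with reduced words in the basis elements and their inverses. For a group $G$, let $\mathcal Q(G)$ be the space of real-valued quasimorphisms on $G$, i.e. functions $\alpha\colon G\to\mathbb R$ with $\sup_{g,h\in G}|\alpha(gh)-\alpha(g)-\alpha(h)|<\infty$, and let $\mathcal H(G)\subseteq \mathcal Q(G)$ be the subspace of homogeneous ones, i.e. those with $\alpha(g^k)=k\,\alpha(g)$ for all $g\in G$, $k\in\mathbb N$, with the topology of pointwise convergence. Every $\alpha\in\mathcal Q(G)$ is at bounded distance from a unique $\widehat\alpha\in\mathcal H(G)$. A map $f\colon G\to K$ between groups is called a quasimorphism if $\alpha\circ f\in\mathcal Q(G)$ for every $\alpha\in\mathcal Q(K)$, and two quasimorphisms $f_1,f_2\colon G\to K$ are equivalent if $\alpha\circ f_1-\alpha\circ f_2$ is bounded for every $\alpha\in\mathcal Q(K)$. Equivalence classes of quasimorphisms $G\to G$ form a monoid under composition, and $\mathrm{QOut}(G)$ denotes its group of invertible elements. It acts on $\mathcal H(G)$ by $[f]^{-1}\cdot\alpha=\widehat{\alpha\circ f}$. A map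 $f\colon F_n\to F_n$ is called quasi-Ulam if there is a finite set $E\subseteq F_n$ such that (1) $f(w_1w_2)\in E f(w_1)E f(w_2)E$ for all words $w_1,w_2$ whose concatenation $w_1w_2$ is a reduced word, and (2) $f(g^{-1})\in E f(g)^{-1}E$ for all $g\in F_n$. Let $\mathrm{QOut}_{qU}(F_n)<\mathrm{QOut}(F_n)$ be the subgroup generated by all elements of $\mathrm{QOut}(F_n)$ that are equivalence classes of bijective quasi-Ulam quasimorphisms $F_n\to F_n$. Then \[ \overline{\mathrm{span}\bigl(\mathrm{QOut}_{qU}(F_n).\mathrm{Hom}(F_n,\mathbb R)\bigr)}=\mathcal H(F_n), \] i.e. the linear span of the set of all $q\cdot\chi$ with $q\in\mathrm{QOut}_{qU}(F_n)$ and $\chi\in\mathrm{Hom}(F_n,\mathbb R)$ is dense in $\mathcal H(F_n)$ for the topology of pointwise convergence. -/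

import Mathlib

open Filter Topology

noncomputable section

namespace QuasiOut

/-! ### Real-valued quasimorphisms -/

/-- A function of bounded absolute value. -/
def IsBdd {X : Type*} (b : X → ℝ) : Prop := ∃ C : ℝ, ∀ x, |b x| ≤ C

/-- The space `𝒬(G)` of real-valued quasimorphisms, i.e. functions with finite defect. -/
def Q (G : Type*) [Group G] : Submodule ℝ (G → ℝ) where
  carrier := {α | ∃ D : ℝ, ∀ g h : G, |α (g * h) - α g - α h| ≤ D}
  add_mem' := by
    rintro α β ⟨D, hD⟩ ⟨E, hE⟩
    refine ⟨D + E, fun g h => ?_⟩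
    have h1 := hD g h
    have h2 := hE g h
    simp only [Pi.add_apply]
    rw [abs_le] at *
    constructor <;> linarith [h1.1, h1.2, h2.1, h2.2]
  zero_mem' := ⟨0, fun g h => by simp⟩
  smul_mem' := by
    rintro c α ⟨D, hD⟩
    refine ⟨|c| * D, fun g h => ?_⟩
    have : (c • α) (g * h) - (c • α) g - (c • α) h = c * (α (g * h) - α g - α h) := by
      simp only [Pi.smul_apply, smul_eq_mul]; ring
    rw [this, abs_mul]
    exact mul_le_mul_of_nonneg_left (hD g h) (abs_nonneg c)

/-- The space `ℋ(G)` of homogeneous real-valued quasimorphisms. As a subspace of `G → ℝ` it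
carries the topology of pointwise convergence. -/
def H (G : Type*) [Group G] : Submodule ℝ (G → ℝ) where
  carrier := {α | α ∈ Q G ∧ ∀ (g : G) (n : ℕ), α (g ^ n) = n * α g}
  add_mem' := by
    rintro α β ⟨hα, hα'⟩ ⟨hβ, hβ'⟩
    refine ⟨(Q G).add_mem hα hβ, fun g n => ?_⟩
    simp only [Pi.add_apply, hα', hβ']; ring
  zero_mem' := ⟨(Q G).zero_mem, fun g n => by simp⟩
  smul_mem' := by
    rintro c α ⟨hα, hα'⟩
    refine ⟨(Q G).smul_mem c hα, fun g n => ?_⟩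
    simp only [Pi.smul_apply, smul_eq_mul, hα']; ring

/-- `Hom(G, ℝ)`, as a subspace of `ℋ(G)`. -/
def homSpace (G : Type*) [Group G] : Submodule ℝ (H G) where
  carrier := {α | ∀ g h : G, α.1 (g * h) = α.1 g + α.1 h}
  add_mem' := by
    intro α β hα hβ g h
    have h1 := hα g h
    have h2 := hβ g h
    simp only [Submodule.coe_add, Pi.add_apply, h1, h2]; ring
  zero_mem' := fun g h => by simp
  smul_mem' := by
    intro c α hα g h
    have h1 := hα g h
    simp only [Submodule.coe_smul, Pi.smul_apply, smul_eq_mul, h1]; ring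

section homogenization

variable {G : Type*} [Group G]

theorem IsBdd.sub {X : Type*} {a b : X → ℝ} (ha : IsBdd a) (hb : IsBdd b) : IsBdd (a - b) := by
  obtain ⟨C, hC⟩ := ha
  obtain ⟨C', hC'⟩ := hb
  exact ⟨C + C', fun x => (abs_sub _ _).trans (add_le_add (hC x) (hC' x))⟩

theorem IsBdd.add {X : Type*} {a b : X → ℝ} (ha : IsBdd a) (hb : IsBdd b) : IsBdd (a + b) := by
  obtain ⟨C, hC⟩ := ha
  obtain ⟨C', hC'⟩ := hb
  exact ⟨C + C', fun x => (abs_add_le _ _).trans (add_le_add (hC x) (hC' x))⟩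

theorem IsBdd.neg {X : Type*} {a : X → ℝ} (ha : IsBdd a) : IsBdd (-a) := by
  obtain ⟨C, hC⟩ := ha
  exact ⟨C, fun x => by simpa using hC x⟩

theorem IsBdd.mem_Q {b : G → ℝ} (hb : IsBdd b) : b ∈ Q G := by
  obtain ⟨C, hC⟩ := hb
  refine ⟨C + C + C, fun g h => ?_⟩
  have h1 := abs_le.1 (hC (g * h))
  have h2 := abs_le.1 (hC g)
  have h3 := abs_le.1 (hC h)
  rw [abs_le]
  constructor <;> linarith [h1.1, h1.2, h2.1, h2.2, h3.1, h3.2]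

theorem pow_defect {α : G → ℝ} {D : ℝ} (hD : ∀ g h : G, |α (g * h) - α g - α h| ≤ D)
    (g : G) (k : ℕ) : |α (g ^ k) - k * α g| ≤ (k + 1) * D := by
  induction k with
  | zero =>
    have := hD 1 1
    simp only [mul_one] at this
    rw [abs_le] at this
    simp only [pow_zero, Nat.cast_zero, zero_mul, sub_zero, zero_add, one_mul]
    rw [abs_le]
    constructor <;> linarith [this.1, this.2]
  | succ k ih =>
    have h1 := abs_le.1 ih
    have h2 := abs_le.1 (hD (g ^ k) g)
    rw [pow_succ, abs_le]
    push_cast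
    constructor <;> linarith [h1.1, h1.2, h2.1, h2.2]

/-- Every quasimorphism is at bounded distance from a homogeneous one. -/
theorem exists_homogenization {α : G → ℝ} (hα : α ∈ Q G) : ∃ β ∈ H G, IsBdd (β - α) := by
  have hα' := hα
  obtain ⟨D, hD⟩ := hα
  have step : ∀ (g : G) (n : ℕ),
      dist (α (g ^ 2 ^ n) / 2 ^ n) (α (g ^ 2 ^ (n + 1)) / 2 ^ (n + 1)) ≤ D / 2 / 2 ^ n := by
    intro g n
    have h := hD (g ^ 2 ^ n) (g ^ 2 ^ n)
    rw [← pow_add, ← two_mul, ← pow_succ'] at h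
    have e : α (g ^ 2 ^ n) / 2 ^ n - α (g ^ 2 ^ (n + 1)) / 2 ^ (n + 1)
        = -(α (g ^ 2 ^ (n + 1)) - α (g ^ 2 ^ n) - α (g ^ 2 ^ n)) / 2 ^ (n + 1) := by
      field_simp; ring
    rw [Real.dist_eq, e, abs_div, abs_neg, abs_of_pos (by positivity : (0 : ℝ) < 2 ^ (n + 1)),
      div_div, ← pow_succ']
    gcongr
  choose β hβ using fun g => cauchySeq_tendsto_of_complete
    (cauchySeq_of_le_geometric_two (step g))
  have hbd : IsBdd (β - α) := by
    refine ⟨D, fun g => ?_⟩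
    have := dist_le_of_le_geometric_two_of_tendsto₀ (step g) (hβ g)
    rw [Real.dist_eq, abs_sub_comm] at this
    simpa using this
  refine ⟨β, ⟨?_, fun g k => ?_⟩, hbd⟩
  · have := (Q G).add_mem hbd.mem_Q hα'
    simpa using this
  · have h0 : Tendsto (fun n : ℕ => ((k : ℝ) + 1) * D / 2 ^ n) atTop (𝓝 0) :=
      tendsto_const_nhds.div_atTop (tendsto_pow_atTop_atTop_of_one_lt one_lt_two)
    have h1 : Tendsto (fun n : ℕ => α ((g ^ k) ^ 2 ^ n) / 2 ^ n - k * (α (g ^ 2 ^ n) / 2 ^ n))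
        atTop (𝓝 0) := by
      refine squeeze_zero_norm (fun n => ?_) h0
      have h := pow_defect hD (g ^ 2 ^ n) k
      have e : α ((g ^ k) ^ 2 ^ n) / 2 ^ n - k * (α (g ^ 2 ^ n) / 2 ^ n)
          = (α ((g ^ 2 ^ n) ^ k) - k * α (g ^ 2 ^ n)) / 2 ^ n := by
        rw [← pow_mul, ← pow_mul, mul_comm k]; ring
      rw [Real.norm_eq_abs, e, abs_div, abs_of_pos (by positivity : (0 : ℝ) < 2 ^ n)]
      gcongr
    have h2 := tendsto_nhds_unique h1 ((hβ (g ^ k)).sub ((hβ g).const_mul (k : ℝ)))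
    linarith

/-- Homogeneous quasimorphisms at bounded distance coincide. -/
theorem eq_of_isBdd_sub {β γ : G → ℝ} (hβ : β ∈ H G) (hγ : γ ∈ H G) (h : IsBdd (β - γ)) :
    β = γ := by
  obtain ⟨C, hC⟩ := h
  funext g
  by_contra hne
  have hpos : 0 < |β g - γ g| := abs_pos.2 (sub_ne_zero.2 hne)
  obtain ⟨n, hn⟩ := exists_nat_gt (C / |β g - γ g|)
  have h1 := hC (g ^ n)
  rw [Pi.sub_apply, hβ.2 g n, hγ.2 g n, ← mul_sub, abs_mul, Nat.abs_cast] at h1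
  rw [div_lt_iff₀ hpos] at hn
  linarith

/-- The homogenization of a quasimorphism: the unique homogeneous quasimorphism at bounded
distance from it. -/
def homogenization (α : Q G) : H G :=
  ⟨(exists_homogenization α.2).choose, (exists_homogenization α.2).choose_spec.1⟩

theorem homogenization_spec (α : Q G) : IsBdd ((homogenization α).1 - α.1) :=
  (exists_homogenization α.2).choose_spec.2

theorem homogenization_eq (α : Q G) (β : H G) (h : IsBdd (β.1 - α.1)) : homogenization α = β := by
  refine Subtype.ext (eq_of_isBdd_sub (homogenization α).2 β.2 ?_)
  have := (homogenization_spec α).sub h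
  simpa using this

end homogenization

/-! ### Quasimorphisms between groups and the quasioutomorphism group -/

/-- A map between groups is a quasimorphism if it pulls back real-valued quasimorphisms to
real-valued quasimorphisms. -/
def IsQuasimorphism {G K : Type*} [Group G] [Group K] (f : G → K) : Prop :=
  ∀ α ∈ Q K, α ∘ f ∈ Q G

/-- Two quasimorphisms are equivalent if their pullbacks of every real-valued quasimorphism on the
target differ by a bounded function. -/
def qmSetoid (G K : Type*) [Group G] [Group K] :
    Setoid {f : G → K // IsQuasimorphism f} where
  r f₁ f₂ := ∀ α ∈ Q K, IsBdd (α ∘ f₁.1 - α ∘ f₂.1)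
  iseqv :=
    { refl := fun f α _ => ⟨0, fun x => by simp⟩
      symm := fun {f₁ f₂} h α hα => by simpa using (h α hα).neg
      trans := fun {f₁ f₂ f₃} h h' α hα => by simpa using (h α hα).add (h' α hα) }

/-- Equivalence classes of quasimorphisms `G → K`: the morphisms of the category of homogeneous
quasigroups. -/
def QQ (G K : Type*) [Group G] [Group K] : Type _ := Quotient (qmSetoid G K)

/-- The class `[f]` of a quasimorphism `f`. -/
def QQ.mk {G K : Type*} [Group G] [Group K] (f : G → K) (hf : IsQuasimorphism f) : QQ G K :=
  Quotient.mk (qmSetoid G K) ⟨f, hf⟩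

section category

variable {G K L : Type*} [Group G] [Group K] [Group L]

theorem IsQuasimorphism.id : IsQuasimorphism (id : G → G) := fun _ hα => hα

theorem IsQuasimorphism.comp {g : K → L} {f : G → K} (hg : IsQuasimorphism g)
    (hf : IsQuasimorphism f) : IsQuasimorphism (g ∘ f) :=
  fun α hα => hf _ (hg α hα)

/-- Composition of classes, `[g] ∘ [f] = [g ∘ f]`. -/
def QQ.comp : QQ K L → QQ G K → QQ G L :=
  Quotient.map₂ (sa := qmSetoid K L) (sb := qmSetoid G K) (sc := qmSetoid G L)
    (fun g f => ⟨g.1 ∘ f.1, g.2.comp f.2⟩) (by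
      intro g₁ g₂ hg f₁ f₂ hf α hα
      obtain ⟨C, hC⟩ := hg α hα
      have h1 : IsBdd (α ∘ g₁.1 ∘ f₁.1 - α ∘ g₂.1 ∘ f₁.1) := ⟨C, fun x => hC (f₁.1 x)⟩
      have h2 : IsBdd (α ∘ g₂.1 ∘ f₁.1 - α ∘ g₂.1 ∘ f₂.1) := hf (α ∘ g₂.1) (g₂.2 α hα)
      have := h1.add h2
      rwa [sub_add_sub_cancel] at this)

/-- The endomorphisms of `G` in the category of homogeneous quasigroups form a monoid under
composition. -/
instance QQ.instMonoid : Monoid (QQ G G) where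
  mul := QQ.comp
  one := QQ.mk id IsQuasimorphism.id
  mul_assoc a b c := by
    induction a using Quotient.inductionOn
    induction b using Quotient.inductionOn
    induction c using Quotient.inductionOn
    rfl
  one_mul a := by
    induction a using Quotient.inductionOn
    rfl
  mul_one a := by
    induction a using Quotient.inductionOn
    rfl

/-- The effect of a class `[f]` on homogeneous quasimorphisms: `α` is sent to the homogenization of `f^*α = α ∘ f`. -/
def QQ.pullback (q : QQ G K) (α : H K) : H G :=
  Quotient.liftOn q (fun f => homogenization ⟨α.1 ∘ f.1, f.2 _ α.2.1⟩) (by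
    intro f₁ f₂ h
    refine homogenization_eq _ _ ?_
    have h1 := homogenization_spec (⟨α.1 ∘ f₂.1, f₂.2 _ α.2.1⟩ : Q G)
    have h2 := h1.sub (h α.1 α.2.1)
    rwa [sub_sub_sub_cancel_right] at h2)

end category

/-- The quasioutomorphism group `QOut(G)`: the automorphism group of `G` in the category of
homogeneous quasigroups. -/
abbrev QOut (G : Type*) [Group G] : Type _ := (QQ G G)ˣ

section action

variable {G : Type*} [Group G]

theorem QQ.pullback_one (α : H G) : QQ.pullback (1 : QQ G G) α = α :=
  homogenization_eq _ _ ⟨0, fun x => by simp⟩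

theorem QQ.pullback_mul (p q : QQ G G) (α : H G) :
    QQ.pullback (p * q) α = QQ.pullback q (QQ.pullback p α) := by
  induction p using Quotient.inductionOn with | _ g
  induction q using Quotient.inductionOn with | _ f
  refine homogenization_eq (G := G) ⟨α.1 ∘ (g.1 ∘ f.1), _⟩ _ ?_
  have h0 := homogenization_spec (⟨α.1 ∘ g.1, g.2 _ α.2.1⟩ : Q G)
  have h1 := homogenization_spec (⟨(homogenization ⟨α.1 ∘ g.1, g.2 _ α.2.1⟩).1 ∘ f.1,
    f.2 _ (homogenization ⟨α.1 ∘ g.1, g.2 _ α.2.1⟩).2.1⟩ : Q G)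
  obtain ⟨C, hC⟩ := h0
  have h2 : IsBdd ((homogenization ⟨α.1 ∘ g.1, g.2 _ α.2.1⟩).1 ∘ f.1 - α.1 ∘ (g.1 ∘ f.1)) :=
    ⟨C, fun x => hC (f.1 x)⟩
  have h3 := h1.add h2
  rwa [sub_add_sub_cancel] at h3

/-- The action of `QOut(G)` on `ℋ(G)`. Pullback is contravariant, so the left action uses the
inverse: `q • α = (q⁻¹)^*α`. -/
instance QOut.instMulAction : MulAction (QOut G) (H G) where
  smul q α := QQ.pullback (↑q⁻¹ : QQ G G) α
  one_smul α := by
    change QQ.pullback (↑(1⁻¹ : QOut G) : QQ G G) α = α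
    rw [inv_one, Units.val_one, QQ.pullback_one]
  mul_smul p q α := by
    change QQ.pullback (↑(p * q)⁻¹ : QQ G G) α
      = QQ.pullback (↑p⁻¹ : QQ G G) (QQ.pullback (↑q⁻¹ : QQ G G) α)
    rw [mul_inv_rev, Units.val_mul, QQ.pullback_mul]

end action

/-! ### Quasi-Ulam quasimorphisms on free groups -/

/-- The quasi-Ulam condition for a map from a free group (with fixed basis `X`) to a group:
there is a finite set `E` with `f(w₁w₂) ∈ E f(w₁) E f(w₂) E` whenever the concatenation `w₁w₂` is a
reduced word, and `f(g⁻¹) ∈ E f(g)⁻¹ E` for all `g`. -/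
def IsQuasiUlam {X G : Type*} [Group G] (f : FreeGroup X → G) : Prop :=
  ∃ E : Finset G,
    (∀ w₁ w₂ : List (X × Bool), FreeGroup.IsReduced (w₁ ++ w₂) →
      ∃ e₁ ∈ E, ∃ e₂ ∈ E, ∃ e₃ ∈ E,
        f (FreeGroup.mk (w₁ ++ w₂)) = e₁ * f (FreeGroup.mk w₁) * e₂ * f (FreeGroup.mk w₂) * e₃) ∧
    (∀ g : FreeGroup X, ∃ e₁ ∈ E, ∃ e₂ ∈ E, f g⁻¹ = e₁ * (f g)⁻¹ * e₂)

/-- The subgroup of `QOut(F)`, for `F` free on `X`, generated by all its elements that are classes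
of bijective quasi-Ulam quasimorphisms `F → F`. -/
def QOutQU (X : Type*) : Subgroup (QOut (FreeGroup X)) :=
  Subgroup.closure {q | ∃ (f : FreeGroup X → FreeGroup X) (hf : IsQuasimorphism f),
    Function.Bijective f ∧ IsQuasiUlam f ∧ (q : QQ (FreeGroup X) (FreeGroup X)) = QQ.mk f hf}

end QuasiOut

end

/-! ### Why the span is dense

Write an element of the free group in its syllable normal form `x₁ ^ k₁ ⋯ x_r ^ k_r`, where adjacent
generators differ and no exponent vanishes. Fix `M` and let `tau M` be the odd involution of `ℤ`
exchanging `k` and `k + M` for `1 ≤ k ≤ M`. A pattern `u`, a list of `N` syllables with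
exponents of absolute value at most `M`, determines an exchange map: it applies `tau M` to the
exponent of every syllable that begins an occurrence of `u` or ends an occurrence of `u⁻¹`. Here
occurrences are tested only up to `tau M`. Hence the exchange does not create or destroy any, no
matter how they overlap, and the map is an involution (`scan_scan`). It changes a syllable by a
bounded amount and only looks at a bounded number of neighbours, up to the first one with an
exponent larger than `2 * M`. So it is quasi-Ulam (`isQuasiUlam_exchangeMap`), and its class is an
element of order at most two of the group generated by bijective quasi-Ulam maps.

Pull back the total exponent sum along the exchange map of `u`, and subtract the total exponent
sum. On cyclic words with exponents at most `M`, the result is up to the factor `± M` the number of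
cyclic occurrences of `u` minus that of `u⁻¹`, because the exchanged partners `k + M` are not
present. Let `u` run over the finite set of all cyclic words with `N` syllables and exponents at most
`M`, and take the linear combination whose coefficients are, up to sign, the values `α u` of a
homogeneous quasimorphism `α`. The patterns that occur in a cyclic word `w` are precisely its `N`
rotations, and the inverse patterns are those of `w⁻¹`. As `α` is odd and conjugation invariant, the
combination takes the value `2 * N * M * α w` (`exists_abs_sum_exchangeMap_sub_le`,
`exists_eq_on_cyclicWords`).

On a finite set of elements, every homogeneous quasimorphism is determined by its values on
generators and on such cyclic words, for suitable `N` and `M`: up to conjugation and powers, every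
element is a power of a generator or a cyclic word with `N` syllables (`exists_detected`). Values on
generators are matched by homomorphisms, so every homogeneous quasimorphism agrees on every finite
set with an element of the span.
-/

noncomputable section

namespace QuasiOut

/-! ### Syllable normal forms in free groups -/

section syllables

variable {X : Type*}

/-- The element `x₁ ^ k₁ * ⋯ * x_r ^ k_r` of the free group spelled by a list of syllables
`(x_i, k_i)`. -/
def sylEval (L : List (X × ℤ)) : FreeGroup X := (L.map fun t => FreeGroup.of t.1 ^ t.2).prod

/-- A list of syllables is reduced if no exponent vanishes and adjacent syllables belong to
different generators. Every element of the free group is spelled by exactly one such list. -/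
def IsSyl (L : List (X × ℤ)) : Prop := (∀ t ∈ L, t.2 ≠ 0) ∧ L.IsChain fun s t => s.1 ≠ t.1

/-- The word in the letters `x^{±1}` obtained by writing out every syllable. -/
def letters (L : List (X × ℤ)) : List (X × Bool) :=
  L.flatMap fun t => List.replicate t.2.natAbs (t.1, decide (0 < t.2))

@[simp] theorem sylEval_nil : sylEval ([] : List (X × ℤ)) = 1 := rfl

@[simp] theorem sylEval_cons (t : X × ℤ) (L : List (X × ℤ)) :
    sylEval (t :: L) = FreeGroup.of t.1 ^ t.2 * sylEval L := by simp [sylEval]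

@[simp] theorem sylEval_append (L L' : List (X × ℤ)) :
    sylEval (L ++ L') = sylEval L * sylEval L' := by simp [sylEval]

theorem isSyl_cons {t : X × ℤ} {L : List (X × ℤ)} :
    IsSyl (t :: L) ↔ t.2 ≠ 0 ∧ (∀ s ∈ L.head?, t.1 ≠ s.1) ∧ IsSyl L := by
  simp only [IsSyl, List.forall_mem_cons, List.isChain_cons]
  tauto

theorem isSyl_append {L L' : List (X × ℤ)} :
    IsSyl (L ++ L') ↔ IsSyl L ∧ IsSyl L' ∧
      ∀ s ∈ L.getLast?, ∀ t ∈ L'.head?, s.1 ≠ t.1 := by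
  simp only [IsSyl, List.forall_mem_append, List.isChain_append]
  tauto

@[simp] theorem letters_cons (t : X × ℤ) (L : List (X × ℤ)) :
    letters (t :: L) = List.replicate t.2.natAbs (t.1, decide (0 < t.2)) ++ letters L := rfl

theorem letters_append (L L' : List (X × ℤ)) : letters (L ++ L') = letters L ++ letters L' := by
  simp [letters]

theorem mk_replicate (x : X) (b : Bool) (m : ℕ) :
    FreeGroup.mk (List.replicate m (x, b)) = FreeGroup.of x ^ (bif b then (m : ℤ) else -m) := by
  induction m with
  | zero => cases b <;> simp [FreeGroup.one_eq_mk]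
  | succ m ih =>
    rw [List.replicate_succ, ← List.singleton_append, ← FreeGroup.mul_mk, ih]
    cases b
    · have h : FreeGroup.mk [(x, false)] = (FreeGroup.of x)⁻¹ := rfl
      rw [h, ← zpow_neg_one, ← zpow_add]
      congr 1
      simp only [cond_false]; push_cast; ring
    · change FreeGroup.of x * _ = _
      nth_rw 1 [← zpow_one (FreeGroup.of x)]
      rw [← zpow_add]
      congr 1
      simp only [cond_true]; push_cast; ring

theorem mk_letters (L : List (X × ℤ)) : FreeGroup.mk (letters L) = sylEval L := by
  induction L with
  | nil => rfl
  | cons t L ih =>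
    rw [letters_cons, ← FreeGroup.mul_mk, ih, mk_replicate, sylEval_cons]
    congr 2
    by_cases h : 0 < t.2
    · simp only [h, decide_true, cond_true]; omega
    · simp only [h, decide_false, cond_false]; omega

theorem head?_letters {t : X × ℤ} (ht : t.2 ≠ 0) (L : List (X × ℤ)) :
    (letters (t :: L)).head? = some (t.1, decide (0 < t.2)) := by
  obtain ⟨m, hm⟩ := Nat.exists_eq_succ_of_ne_zero (Int.natAbs_ne_zero.2 ht)
  rw [letters_cons, hm, List.replicate_succ]
  rfl

theorem getLast?_letters {t : X × ℤ} (ht : t.2 ≠ 0) (L : List (X × ℤ)) :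
    (letters (L ++ [t])).getLast? = some (t.1, decide (0 < t.2)) := by
  obtain ⟨m, hm⟩ := Nat.exists_eq_succ_of_ne_zero (Int.natAbs_ne_zero.2 ht)
  rw [letters_append, letters_cons, hm, List.replicate_succ']
  simp [letters]

theorem isReduced_letters {L : List (X × ℤ)} (hL : IsSyl L) : FreeGroup.IsReduced (letters L) := by
  induction L with
  | nil => exact FreeGroup.IsReduced.nil
  | cons t L ih =>
    rw [isSyl_cons] at hL
    obtain ⟨h0, h1, h2⟩ := hL
    rw [letters_cons, FreeGroup.IsReduced, List.isChain_append]
    refine ⟨List.isChain_replicate_of_rel _ fun _ => rfl, ih h2, fun a ha b hb hab => ?_⟩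
    have ha' := List.eq_of_mem_replicate (List.mem_of_mem_getLast? ha)
    cases L with
    | nil => simp [letters] at hb
    | cons s L =>
      rw [head?_letters (isSyl_cons.1 h2).1] at hb
      obtain rfl : _ = b := by simpa using hb
      subst ha'
      exact absurd hab (h1 s rfl)

section normalForm

variable [DecidableEq X]

/-- Multiplication of a syllable list by a letter on the left, provided the letter does not
cancel. -/
def pushLetter (a : X × Bool) : List (X × ℤ) → List (X × ℤ)
  | [] => [(a.1, bif a.2 then 1 else -1)]
  | t :: T => if a.1 = t.1 then (t.1, t.2 + bif a.2 then 1 else -1) :: T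
      else (a.1, bif a.2 then 1 else -1) :: t :: T

/-- The syllable normal form of an element of the free group. -/
def syl (g : FreeGroup X) : List (X × ℤ) := g.toWord.foldr pushLetter []

theorem foldr_pushLetter_spec {w : List (X × Bool)} (hw : FreeGroup.IsReduced w) :
    IsSyl (w.foldr pushLetter []) ∧ letters (w.foldr pushLetter []) = w := by
  induction w with
  | nil => exact ⟨⟨by simp, by simp⟩, rfl⟩
  | cons a w ih =>
    obtain ⟨x, b⟩ := a
    rw [FreeGroup.IsReduced, List.isChain_cons] at hw
    obtain ⟨h1, h2⟩ := ih hw.2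
    rw [List.foldr_cons]
    generalize w.foldr pushLetter [] = S at h1 h2
    cases S with
    | nil =>
      obtain rfl : [] = w := h2
      constructor
      · cases b <;> simp [pushLetter, IsSyl]
      · cases b <;> simp [pushLetter, letters]
    | cons t T =>
      have ht := isSyl_cons.1 h1
      have hb := hw.1 (t.1, decide (0 < t.2)) (by rw [← h2, head?_letters ht.1]; rfl)
      obtain ⟨y, k⟩ := t
      simp only at ht hb
      by_cases hx : x = y
      · subst hx
        have hb' := hb rfl
        subst hb'
        simp only [pushLetter, if_true]
        rcases lt_or_gt_of_ne ht.1 with hk | hk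
        · have e : decide (0 < k) = false := by simp; omega
          rw [e]
          simp only [cond_false]
          refine ⟨isSyl_cons.2 ⟨by simp only; omega, ht.2⟩, ?_⟩
          rw [← h2, letters_cons, letters_cons]
          have e2 : decide (0 < k + -1) = false := by simp; omega
          have e3 : (k + -1).natAbs = k.natAbs + 1 := by omega
          simp only [e, e2, e3, List.replicate_succ, List.cons_append]
        · have e : decide (0 < k) = true := by simp; omega
          rw [e]
          simp only [cond_true]
          refine ⟨isSyl_cons.2 ⟨by simp only; omega, ht.2⟩, ?_⟩
          rw [← h2, letters_cons, letters_cons]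
          have e2 : decide (0 < k + 1) = true := by simp; omega
          have e3 : (k + 1).natAbs = k.natAbs + 1 := by omega
          simp only [e, e2, e3, List.replicate_succ, List.cons_append]
      · simp only [pushLetter, if_neg hx]
        refine ⟨isSyl_cons.2 ⟨by cases b <;> simp, by simpa using hx, h1⟩, ?_⟩
        rw [letters_cons, h2]
        cases b <;> simp

theorem foldr_pushLetter_replicate {T : List (X × ℤ)} {x : X} (hT : ∀ s ∈ T.head?, x ≠ s.1)
    (b : Bool) (m : ℕ) : (List.replicate (m + 1) (x, b)).foldr pushLetter T =
      (x, bif b then ((m : ℤ) + 1) else -((m : ℤ) + 1)) :: T := by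
  induction m with
  | zero =>
    cases T with
    | nil => cases b <;> simp [pushLetter]
    | cons s T =>
      have := hT s rfl
      cases b <;> simp [pushLetter, this]
  | succ m ih =>
    rw [List.replicate_succ, List.foldr_cons, ih]
    cases b <;> simp [pushLetter]; ring

theorem foldr_pushLetter_letters {L : List (X × ℤ)} (hL : IsSyl L) :
    (letters L).foldr pushLetter [] = L := by
  induction L with
  | nil => rfl
  | cons t L ih =>
    rw [isSyl_cons] at hL
    rw [letters_cons, List.foldr_append, ih hL.2.2]
    obtain ⟨m, hm⟩ := Nat.exists_eq_succ_of_ne_zero (Int.natAbs_ne_zero.2 hL.1)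
    rw [hm, foldr_pushLetter_replicate hL.2.1]
    congr 1
    ext
    · rfl
    · by_cases h : 0 < t.2 <;> simp [h] <;> omega

theorem isSyl_syl (g : FreeGroup X) : IsSyl (syl g) :=
  (foldr_pushLetter_spec FreeGroup.isReduced_toWord).1

theorem letters_syl (g : FreeGroup X) : letters (syl g) = g.toWord :=
  (foldr_pushLetter_spec FreeGroup.isReduced_toWord).2

theorem sylEval_syl (g : FreeGroup X) : sylEval (syl g) = g := by
  rw [← mk_letters, letters_syl, FreeGroup.mk_toWord]

theorem toWord_sylEval {L : List (X × ℤ)} (hL : IsSyl L) : (sylEval L).toWord = letters L := by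
  rw [← mk_letters, FreeGroup.toWord_mk, (isReduced_letters hL).reduce_eq]

theorem syl_sylEval {L : List (X × ℤ)} (hL : IsSyl L) : syl (sylEval L) = L := by
  rw [syl, toWord_sylEval hL, foldr_pushLetter_letters hL]

/-- The normal form of a concatenation that is reduced: either no syllables meet at the seam, or
the two syllables meeting there have exponents of the same sign and merge into one. -/
theorem syl_mk_append {w₁ w₂ : List (X × Bool)} (h : FreeGroup.IsReduced (w₁ ++ w₂)) :
    syl (FreeGroup.mk (w₁ ++ w₂)) = syl (FreeGroup.mk w₁) ++ syl (FreeGroup.mk w₂) ∨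
    ∃ (A B : List (X × ℤ)) (x : X) (k₁ k₂ : ℤ), 0 < k₁ * k₂ ∧
      syl (FreeGroup.mk w₁) = A ++ [(x, k₁)] ∧ syl (FreeGroup.mk w₂) = (x, k₂) :: B ∧
      syl (FreeGroup.mk (w₁ ++ w₂)) = A ++ (x, k₁ + k₂) :: B := by
  have h' := List.isChain_append.1 h
  have l1 := letters_syl (FreeGroup.mk w₁)
  have l2 := letters_syl (FreeGroup.mk w₂)
  have i1 := isSyl_syl (FreeGroup.mk w₁)
  have i2 := isSyl_syl (FreeGroup.mk w₂)
  have e1 := sylEval_syl (FreeGroup.mk w₁)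
  have e2 := sylEval_syl (FreeGroup.mk w₂)
  rw [FreeGroup.toWord_mk, FreeGroup.IsReduced.reduce_eq h'.1] at l1
  rw [FreeGroup.toWord_mk, FreeGroup.IsReduced.reduce_eq h'.2.1] at l2
  rw [← FreeGroup.mul_mk, ← e1, ← e2, syl_sylEval i1, syl_sylEval i2]
  generalize syl (FreeGroup.mk w₁) = S₁ at *
  generalize syl (FreeGroup.mk w₂) = S₂ at *
  by_cases hs : ∀ s ∈ S₁.getLast?, ∀ t ∈ S₂.head?, s.1 ≠ t.1
  · left
    rw [← sylEval_append, syl_sylEval (isSyl_append.2 ⟨i1, i2, hs⟩)]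
  · right
    push Not at hs
    obtain ⟨⟨x, k₁⟩, hs, ⟨y, k₂⟩, ht, hxy⟩ := hs
    obtain rfl : x = y := hxy
    obtain ⟨A, rfl⟩ : ∃ A, S₁ = A ++ [(x, k₁)] := by
      obtain ⟨hne, he⟩ := List.mem_getLast?_eq_getLast hs
      exact ⟨S₁.dropLast, by rw [he, List.dropLast_append_getLast]⟩
    obtain ⟨B, rfl⟩ : ∃ B, S₂ = (x, k₂) :: B := by
      cases S₂ with
      | nil => simp at ht
      | cons s B => exact ⟨B, by simpa using ht⟩
    have j1 := isSyl_append.1 i1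
    have j2 := isSyl_cons.1 i2
    have hk1 : k₁ ≠ 0 := (isSyl_cons.1 j1.2.1).1
    have hk2 : k₂ ≠ 0 := j2.1
    have hsign : decide (0 < k₁) = decide (0 < k₂) :=
      h'.2.2 (x, decide (0 < k₁)) (by rw [← l1]; exact getLast?_letters (t := (x, k₁)) hk1 A)
        (x, decide (0 < k₂)) (by rw [← l2]; exact head?_letters (t := (x, k₂)) hk2 B) rfl
    have hpos : 0 < k₁ * k₂ := by
      rcases lt_or_gt_of_ne hk1 with h1 | h1 <;> rcases lt_or_gt_of_ne hk2 with h2 | h2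
      · exact mul_pos_of_neg_of_neg h1 h2
      · simp [h2] at hsign; omega
      · simp [h1] at hsign; omega
      · exact mul_pos h1 h2
    refine ⟨A, B, x, k₁, k₂, hpos, rfl, rfl, ?_⟩
    have hsum : k₁ + k₂ ≠ 0 := by
      intro h0
      obtain rfl : k₂ = -k₁ := by omega
      nlinarith [mul_self_nonneg k₁]
    rw [← syl_sylEval (L := A ++ (x, k₁ + k₂) :: B)
      (isSyl_append.2 ⟨j1.1, isSyl_cons.2 ⟨hsum, j2.2⟩, by simpa using j1.2.2⟩)]
    congr 1
    simp only [sylEval_append, sylEval_cons, sylEval_nil, mul_one, zpow_add]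
    group

end normalForm

end syllables

/-! ### Context-dependent maps on lists -/

section scan

variable {S β : Type*}

/-- The list of values `e A t B`, where `t` runs through the entries of a list, `A` is the reversed
list of everything to the left of `t` and `B` the list of everything to the right of `t`. The
list is scanned inside a larger one, which continues it by the first argument (reversed) to the
left and by the last argument to the right. -/
def scan (e : List S → S → List S → β) : List S → List S → List S → List β
  | _, [], _ => []
  | A, t :: B, C => e A t (B ++ C) :: scan e (t :: A) B C

variable (e : List S → S → List S → β)

@[simp] theorem scan_nil (A C : List S) : scan e A [] C = [] := rfl

@[simp] theorem scan_cons (A : List S) (t : S) (B C : List S) :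
    scan e A (t :: B) C = e A t (B ++ C) :: scan e (t :: A) B C := rfl

theorem scan_append (A B B' C : List S) :
    scan e A (B ++ B') C = scan e A B (B' ++ C) ++ scan e (B.reverse ++ A) B' C := by
  induction B generalizing A with
  | nil => rfl
  | cons t B ih => simp [ih]

/-- If the value at `t` agrees with `t` after applying `p`, then scanning preserves the image
under `p`. -/
theorem map_scan {γ : Type*} {p : β → γ} {q : S → γ} (h : ∀ A t B, p (e A t B) = q t)
    (A B C : List S) : (scan e A B C).map p = B.map q := by
  induction B generalizing A with
  | nil => rfl
  | cons t B ih => simp [ih, h]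

theorem forall_mem_scan {P : β → Prop} {R : S → Prop} (h : ∀ A t B, R t → P (e A t B))
    (A B C : List S) (hB : ∀ t ∈ B, R t) : ∀ b ∈ scan e A B C, P b := by
  induction B generalizing A with
  | nil => simp
  | cons t B ih =>
    rw [List.forall_mem_cons] at hB
    simpa using ⟨h _ _ _ hB.1, by simpa using ih (t :: A) hB.2⟩

theorem reverse_scan (A B C : List S) :
    (scan e A B C).reverse = scan (fun A t B => e B t A) C B.reverse A := by
  induction B generalizing A C with
  | nil => rfl
  | cons t B ih => rw [scan_cons, List.reverse_cons, ih, List.reverse_cons, scan_append]; simp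

theorem scan_map {S' β' : Type*} (e' : List S' → S' → List S' → β') (φ : S → S') (ψ : β → β')
    (h : ∀ A t B, e' (A.map φ) (φ t) (B.map φ) = ψ (e A t B)) (A B C : List S) :
    scan e' (A.map φ) (B.map φ) (C.map φ) = (scan e A B C).map ψ := by
  induction B generalizing A with
  | nil => rfl
  | cons t B ih =>
    rw [List.map_cons, scan_cons, scan_cons, List.map_cons, ← List.map_cons, ih, ← List.map_append,
      h]

theorem scan_congr {A A' C C' : List S} {e' : List S → S → List S → β} (B : List S)
    (h : ∀ B₁ t B₂, B = B₁ ++ t :: B₂ →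
      e (B₁.reverse ++ A) t (B₂ ++ C) = e' (B₁.reverse ++ A') t (B₂ ++ C')) :
    scan e A B C = scan e' A' B C' := by
  induction B generalizing A A' with
  | nil => rfl
  | cons t B ih =>
    rw [scan_cons, scan_cons]
    congr 1
    · exact h [] t B rfl
    · refine ih fun B₁ s B₂ hB => ?_
      have := h (t :: B₁) s B₂ (by rw [hB]; rfl)
      simpa using this

end scan

/-! ### Exchanging short and medium exponents -/

section exchange

/-- The odd involution of `ℤ` exchanging `k` and `k + M`, as well as `-k` and `-(k + M)`, for
`1 ≤ k ≤ M`. -/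
def tau (M : ℕ) (k : ℤ) : ℤ :=
  if |k| ≤ M then k + M * k.sign else if |k| ≤ 2 * M then k - M * k.sign else k

/-- A retraction of `ℤ` whose fibres are the orbits of `tau M`. -/
def tauMin (M : ℕ) (k : ℤ) : ℤ := if M < |k| ∧ |k| ≤ 2 * M then k - M * k.sign else k

variable (M : ℕ) (k : ℤ)

theorem tau_of_le {M : ℕ} {k : ℤ} (h : |k| ≤ M) : tau M k = k + M * k.sign := if_pos h

theorem tauMin_of_le {M : ℕ} {k : ℤ} (h : |k| ≤ M) : tauMin M k = k :=
  if_neg fun h' => absurd h'.1 (not_lt.2 h)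

theorem tauMin_of_lt {M : ℕ} {k : ℤ} (h : 2 * M < |k|) : tauMin M k = k :=
  if_neg fun h' => absurd h'.2 (not_le.2 h)

theorem tau_tau : tau M (tau M k) = k := by
  rcases lt_trichotomy k 0 with h | rfl | h
  · simp only [tau, Int.sign_eq_neg_one_of_neg h, abs_of_neg h]
    split_ifs with h1 h2 h3 h4 h5 h6 <;>
      first
      | omega
      | (rw [Int.sign_eq_neg_one_of_neg (by omega)]; omega)
      | (rw [abs_of_neg (by omega)] at *; omega)
  · simp [tau]
  · simp only [tau, Int.sign_eq_one_of_pos h, abs_of_pos h]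
    split_ifs with h1 h2 h3 h4 h5 h6 <;>
      first
      | omega
      | (rw [Int.sign_eq_one_of_pos (by omega)]; omega)
      | (rw [abs_of_pos (by omega)] at *; omega)

theorem tauMin_tau : tauMin M (tau M k) = tauMin M k := by
  rcases lt_trichotomy k 0 with h | rfl | h
  · simp only [tau, tauMin, Int.sign_eq_neg_one_of_neg h, abs_of_neg h]
    split_ifs with h1 h2 h3 h4 h5 h6 <;>
      first
      | omega
      | (rw [Int.sign_eq_neg_one_of_neg (by omega)]; omega)
      | (rw [abs_of_neg (by omega)] at *; omega)
  · simp [tau, tauMin]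
  · simp only [tau, tauMin, Int.sign_eq_one_of_pos h, abs_of_pos h]
    split_ifs with h1 h2 h3 h4 h5 h6 <;>
      first
      | omega
      | (rw [Int.sign_eq_one_of_pos (by omega)]; omega)
      | (rw [abs_of_pos (by omega)] at *; omega)

theorem tau_neg : tau M (-k) = -tau M k := by
  simp only [tau, abs_neg, Int.sign_neg]
  split_ifs <;> ring

theorem tauMin_neg : tauMin M (-k) = -tauMin M k := by
  simp only [tauMin, abs_neg, Int.sign_neg]
  split_ifs <;> ring

theorem tau_ne_zero {k : ℤ} (hk : k ≠ 0) : tau M k ≠ 0 := fun h => by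
  have := tau_tau M k
  rw [h] at this
  exact hk (by rw [← this]; simp [tau])

theorem abs_tau_sub_le : |tau M k - k| ≤ M := by
  rcases lt_trichotomy k 0 with h | rfl | h
  · simp only [tau, Int.sign_eq_neg_one_of_neg h]
    split_ifs <;> (rw [abs_le]; constructor <;> omega)
  · simp [tau]
  · simp only [tau, Int.sign_eq_one_of_pos h]
    split_ifs <;> (rw [abs_le]; constructor <;> omega)

theorem tau_of_lt {M : ℕ} {k : ℤ} (h : 2 * M < |k|) : tau M k = k := by
  rw [tau, if_neg (by omega), if_neg (by omega)]

end exchange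

/-! ### The exchange map attached to a pattern -/

section pattern

variable {X : Type*}

/-- The inverse of a syllable. -/
def sylInv (t : X × ℤ) : X × ℤ := (t.1, -t.2)

@[simp] theorem sylInv_sylInv (t : X × ℤ) : sylInv (sylInv t) = t := by simp [sylInv]

@[simp] theorem sylInv_comp_sylInv : (sylInv ∘ sylInv : X × ℤ → X × ℤ) = id := by
  ext1 t; simp

theorem sylEval_reverse_map_sylInv (L : List (X × ℤ)) :
    sylEval (L.map sylInv).reverse = (sylEval L)⁻¹ := by
  induction L with
  | nil => simp
  | cons t L ih => simp [ih, sylInv]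

theorem isSyl_reverse_map_sylInv {L : List (X × ℤ)} (hL : IsSyl L) :
    IsSyl (L.map sylInv).reverse := by
  refine ⟨?_, ?_⟩
  · intro t ht
    obtain ⟨s, hs, rfl⟩ := List.mem_map.1 (List.mem_reverse.1 ht)
    simpa [sylInv] using hL.1 s hs
  · rw [List.isChain_reverse, List.isChain_map]
    exact hL.2.imp fun _ _ h => h.symm

/-- The class of a syllable under exchanging exponents by `tau M`. -/
def sylMin (M : ℕ) (t : X × ℤ) : X × ℤ := (t.1, tauMin M t.2)

theorem sylMin_sylInv (M : ℕ) (t : X × ℤ) : sylMin M (sylInv t) = sylInv (sylMin M t) := by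
  simp [sylMin, sylInv, tauMin_neg]

/-- The syllable `t`, with `A` to its left (reversed) and `B` to its right, begins an occurrence of
the pattern `u`, or ends an occurrence of the inverse pattern. Exponents are only looked at up to
`tau M`. -/
def Occurs (u : List (X × ℤ)) (M : ℕ) (A : List (X × ℤ)) (t : X × ℤ) (B : List (X × ℤ)) : Prop :=
  u <+: (t :: B).map (sylMin M) ∨ u <+: ((t :: A).map sylInv).map (sylMin M)

open Classical in
/-- The syllable replacing `t`: its exponent is exchanged by `tau M` where the pattern occurs. -/
def exchange (u : List (X × ℤ)) (M : ℕ) (A : List (X × ℤ)) (t : X × ℤ) (B : List (X × ℤ)) :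
    X × ℤ := (t.1, if Occurs u M A t B then tau M t.2 else t.2)

variable (u : List (X × ℤ)) (M : ℕ)

theorem occurs_symm (A : List (X × ℤ)) (t : X × ℤ) (B : List (X × ℤ)) :
    Occurs u M (A.map sylInv) (sylInv t) (B.map sylInv) ↔ Occurs u M B t A := by
  rw [Occurs, Occurs, or_comm, ← List.map_cons, ← List.map_cons]
  simp only [List.map_map]
  rw [show sylMin M ∘ sylInv ∘ sylInv = sylMin (X := X) M by rw [sylInv_comp_sylInv]; rfl]

theorem occurs_congr {A A' B B' : List (X × ℤ)} {t t' : X × ℤ}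
    (hA : A.map (sylMin M) = A'.map (sylMin M)) (ht : sylMin M t = sylMin M t')
    (hB : B.map (sylMin M) = B'.map (sylMin M)) : Occurs u M A t B ↔ Occurs u M A' t' B' := by
  have hc : sylMin (X := X) M ∘ sylInv = sylInv ∘ sylMin M := funext fun t => sylMin_sylInv M t
  have hA' := congrArg (List.map sylInv) hA
  rw [List.map_map, List.map_map] at hA'
  simp only [Occurs, List.map_cons, List.map_map, hc, ht, hB, sylMin_sylInv, hA']

theorem exchange_congr {A A' B B' : List (X × ℤ)} {t : X × ℤ}
    (h : Occurs u M A t B ↔ Occurs u M A' t B') : exchange u M A t B = exchange u M A' t B' := by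
  by_cases h' : Occurs u M A t B
  · rw [exchange, exchange, if_pos h', if_pos (h.1 h')]
  · rw [exchange, exchange, if_neg h', if_neg fun h'' => h' (h.2 h'')]

theorem exchange_symm (A : List (X × ℤ)) (t : X × ℤ) (B : List (X × ℤ)) :
    exchange u M (A.map sylInv) (sylInv t) (B.map sylInv) = sylInv (exchange u M B t A) := by
  have hs := occurs_symm u M A t B
  by_cases h : Occurs u M B t A
  · rw [exchange, exchange, if_pos h, if_pos (hs.2 h)]
    simp [sylInv, tau_neg]
  · rw [exchange, exchange, if_neg h, if_neg (fun h' => h (hs.1 h'))]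

theorem sylMin_exchange (A : List (X × ℤ)) (t : X × ℤ) (B : List (X × ℤ)) :
    sylMin M (exchange u M A t B) = sylMin M t := by
  by_cases h : Occurs u M A t B <;> simp [exchange, h, sylMin, tauMin_tau]

theorem exchange_exchange {A A' B B' : List (X × ℤ)} (t : X × ℤ)
    (hA : A'.map (sylMin M) = A.map (sylMin M)) (hB : B'.map (sylMin M) = B.map (sylMin M)) :
    exchange u M A' (exchange u M A t B) B' = t := by
  have h := occurs_congr u M hA (sylMin_exchange u M A t B) hB
  by_cases h' : Occurs u M A t B
  · rw [exchange, if_pos (h.2 h')]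
    simp [exchange, h', tau_tau]
  · rw [exchange, if_neg (fun h'' => h' (h.1 h''))]
    simp [exchange, h']

/-- Scanning with `exchange` is an involution because occurrences of the pattern are only tested up
to `tau M`, so that they are not affected by the exchange. -/
theorem scan_scan {A A' C C' : List (X × ℤ)} (B : List (X × ℤ))
    (hA : A'.map (sylMin M) = A.map (sylMin M)) (hC : C'.map (sylMin M) = C.map (sylMin M)) :
    scan (exchange u M) A' (scan (exchange u M) A B C) C' = B := by
  induction B generalizing A A' with
  | nil => rfl
  | cons t B ih =>
    rw [scan_cons, scan_cons, ih (by simp [hA, sylMin_exchange]),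
      exchange_exchange u M t hA]
    rw [List.map_append, List.map_append, hC, map_scan _ (sylMin_exchange u M)]

theorem scan_exchange_inv (A B C : List (X × ℤ)) :
    scan (exchange u M) (C.map sylInv) (B.map sylInv).reverse (A.map sylInv) =
      ((scan (exchange u M) A B C).map sylInv).reverse := by
  rw [← scan_map (exchange u M) (fun A t B => exchange u M B t A) sylInv sylInv
    (fun A t B => exchange_symm u M B t A), reverse_scan]

theorem isSyl_scan_exchange {A B C : List (X × ℤ)} (hB : IsSyl B) :
    IsSyl (scan (exchange u M) A B C) := by
  refine ⟨forall_mem_scan _ (R := fun t => t.2 ≠ 0) ?_ _ _ _ hB.1, ?_⟩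
  · intro A t B ht
    simp only [exchange]
    split_ifs
    exacts [tau_ne_zero M ht, ht]
  · have h := (List.isChain_map (R := fun x y : X => x ≠ y) Prod.fst
      (l := scan (exchange u M) A B C)).1
    refine h ?_
    rw [map_scan (exchange u M) (p := Prod.fst) (q := Prod.fst) (fun _ _ _ => rfl),
      List.isChain_map]
    exact hB.2

theorem abs_exchange_sub_le (A : List (X × ℤ)) (t : X × ℤ) (B : List (X × ℤ)) :
    |(exchange u M A t B).2 - t.2| ≤ M := by
  simp only [exchange]
  split_ifs
  · exact abs_tau_sub_le M t.2
  · simp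

theorem exchange_of_lt {A : List (X × ℤ)} {t : X × ℤ} {B : List (X × ℤ)} (ht : 2 * M < |t.2|) :
    exchange u M A t B = t := by
  ext
  · rfl
  · simp [exchange, tau_of_lt ht]

end pattern

/-! ### Exchange maps are bijective and quasi-Ulam -/

section quasiUlam

variable {X : Type*} {u : List (X × ℤ)} {M : ℕ}

theorem prefix_append_cons_iff {S : Type*} {u l l' : List S} {d : S} (hd : d ∉ u) :
    u <+: l ++ d :: l' ↔ u <+: l := by
  refine ⟨fun h => ?_, fun h => h.trans (List.prefix_append _ _)⟩
  by_cases hl : u.length ≤ l.length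
  · exact List.prefix_of_prefix_length_le h (List.prefix_append _ _) hl
  · have h1 : l ++ [d] <+: l ++ d :: l' := ⟨l', by simp⟩
    have h2 := List.prefix_of_prefix_length_le h1 h (by simp; omega)
    exact absurd (h2.subset (by simp)) hd

/-- A syllable with a long exponent is a barrier: it hides everything behind it. -/
theorem occurs_append_cons_iff (hu : ∀ s ∈ u, |s.2| ≤ M) {d : X × ℤ} (hd : 2 * M < |d.2|)
    (A : List (X × ℤ)) (t : X × ℤ) (B C : List (X × ℤ)) :
    Occurs u M A t (B ++ d :: C) ↔ Occurs u M A t B := by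
  have hd' : sylMin M d ∉ u := fun h => by
    have := hu _ h
    simp only [sylMin, tauMin_of_lt hd] at this
    omega
  rw [Occurs, Occurs, ← List.cons_append, List.map_append, List.map_cons (a := d),
    prefix_append_cons_iff hd']

theorem occurs_append_iff {D : List (X × ℤ)} (hD : u.length ≤ D.length)
    (A : List (X × ℤ)) (t : X × ℤ) (B C : List (X × ℤ)) :
    Occurs u M A t (B ++ (D ++ C)) ↔ Occurs u M A t (B ++ D) := by
  rw [Occurs, Occurs, ← List.append_assoc, ← List.cons_append, List.map_append (l₂ := C)]
  refine or_congr_left ⟨fun h => ?_, fun h => h.trans (List.prefix_append _ _)⟩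
  exact List.prefix_of_prefix_length_le h (List.prefix_append _ _) (by simp; omega)

theorem scan_append_cons (hu : ∀ s ∈ u, |s.2| ≤ M) {d : X × ℤ} (hd : 2 * M < |d.2|)
    (P A D C : List (X × ℤ)) :
    scan (exchange u M) P A (D ++ d :: C) = scan (exchange u M) P A D := by
  refine scan_congr _ A fun B₁ t B₂ _ => ?_
  rw [← List.append_assoc]
  exact exchange_congr u M (occurs_append_cons_iff hu hd _ _ _ _)

theorem scan_append_right {D : List (X × ℤ)} (hD : u.length ≤ D.length) (P A C : List (X × ℤ)) :
    scan (exchange u M) P A (D ++ C) = scan (exchange u M) P A D := by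
  refine scan_congr _ A fun B₁ t B₂ _ => ?_
  exact exchange_congr u M (occurs_append_iff hD _ _ _ _)

theorem sylEval_scan_eq_inv (u : List (X × ℤ)) (M : ℕ) (P B : List (X × ℤ)) :
    sylEval (scan (exchange u M) P B []) =
      (sylEval (scan (exchange u M) [] (B.map sylInv).reverse (P.map sylInv)))⁻¹ := by
  have h := scan_exchange_inv u M P B []
  rw [List.map_nil] at h
  rw [h, sylEval_reverse_map_sylInv, inv_inv]

variable [DecidableEq X]

theorem norm_of_zpow_le (x : X) (k : ℤ) : (FreeGroup.of x ^ k).norm ≤ k.natAbs := by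
  obtain ⟨m, rfl | rfl⟩ := Int.eq_nat_or_neg k
  · rw [zpow_natCast, FreeGroup.norm_of_pow]; simp
  · rw [zpow_neg, zpow_natCast, FreeGroup.norm_inv_eq, FreeGroup.norm_of_pow]; simp

theorem norm_mul₃_le (a b c : FreeGroup X) : (a * b * c).norm ≤ a.norm + b.norm + c.norm :=
  (FreeGroup.norm_mul_le _ _).trans (Nat.add_le_add_right (FreeGroup.norm_mul_le _ _) _)

/-- Enlarging the right context changes the result of a scan only by a bounded right factor. Of
the syllables near the seam, those followed by a syllable with a long exponent are not affected, and
the others are too short to contribute more than a bounded amount. -/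
theorem norm_inv_scan_mul_scan_le (hu : ∀ s ∈ u, |s.2| ≤ M) (P A D C : List (X × ℤ)) :
    ((sylEval (scan (exchange u M) P A D))⁻¹ *
      sylEval (scan (exchange u M) P A (D ++ C))).norm ≤ (u.length - D.length) * (6 * M) := by
  induction A using List.reverseRecOn generalizing D with
  | nil => simp
  | append_singleton A t ih =>
    by_cases hlong : ∃ d ∈ D, 2 * M < |d.2|
    · obtain ⟨d, hd, hd'⟩ := hlong
      obtain ⟨D₁, D₂, rfl⟩ := List.append_of_mem hd
      rw [List.append_assoc, List.cons_append, scan_append_cons hu hd', scan_append_cons hu hd']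
      simp
    by_cases hlen : u.length ≤ D.length
    · rw [scan_append_right hlen]; simp
    have ih' := ih (t :: D)
    have h1 := abs_le.1 (abs_exchange_sub_le u M (A.reverse ++ P) t D)
    have h2 := abs_le.1 (abs_exchange_sub_le u M (A.reverse ++ P) t (D ++ C))
    have hmul : (u.length - D.length) * (6 * M) =
        (u.length - (t :: D).length) * (6 * M) + 6 * M := by
      rw [← Nat.succ_mul]; congr 1; simp only [List.length_cons]; omega
    rw [hmul, scan_append, scan_append]
    simp only [scan_cons, scan_nil, sylEval_append, sylEval_cons, sylEval_nil, mul_one,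
      List.nil_append, List.singleton_append, mul_inv_rev, ← List.cons_append]
    have hx : ∀ B, (exchange u M (A.reverse ++ P) t B).1 = t.1 := fun _ => rfl
    rw [hx, hx]
    generalize (exchange u M (A.reverse ++ P) t D).2 = k at h1 ⊢
    generalize (exchange u M (A.reverse ++ P) t (D ++ C)).2 = k' at h2 ⊢
    by_cases ht : 2 * M < |t.2|
    · have e1 := scan_append_cons hu ht P A [] D
      have e2 := scan_append_cons hu ht P A [] (D ++ C)
      simp only [List.nil_append] at e1 e2
      rw [e1, List.cons_append, e2, mul_assoc, inv_mul_cancel_left, ← zpow_neg, ← zpow_add]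
      have := norm_of_zpow_le t.1 (-k + k')
      omega
    · rw [mul_assoc, ← mul_assoc (sylEval _)⁻¹, ← mul_assoc]
      refine (norm_mul₃_le _ _ _).trans ?_
      have n1 := norm_of_zpow_le t.1 k
      have n2 := norm_of_zpow_le t.1 k'
      rw [FreeGroup.norm_inv_eq]
      have := abs_le.1 (not_lt.1 ht)
      omega

/-- The part of a scan to the left of a merged syllable `x ^ (k₁ + k₂)`, compared with the scan of
the list that ends in `x ^ k₁`. -/
theorem norm_inv_scan_mul_scan_mul_le (hu : ∀ s ∈ u, |s.2| ≤ M) (A C : List (X × ℤ)) (x : X)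
    {k₁ k₂ : ℤ} (hk : 0 < k₁ * k₂) :
    ((sylEval (scan (exchange u M) [] (A ++ [(x, k₁)]) []))⁻¹ *
      sylEval (scan (exchange u M) [] A ((x, k₁ + k₂) :: C)) * FreeGroup.of x ^ k₁).norm ≤
      2 * (u.length * (6 * M)) + 6 * M := by
  rw [scan_append]
  simp only [scan_cons, scan_nil, sylEval_append, sylEval_cons, sylEval_nil, mul_one,
    List.append_nil, mul_inv_rev]
  have hx : (exchange u M A.reverse (x, k₁) []).1 = x := rfl
  have h1 := abs_le.1 (abs_exchange_sub_le u M A.reverse (x, k₁) [])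
  rw [hx]
  by_cases hl : 2 * M < |k₁|
  · have hl' : 2 * M < |k₁ + k₂| := by
      rcases pos_and_pos_or_neg_and_neg_of_mul_pos hk with ⟨h, h'⟩ | ⟨h, h'⟩
      · rw [abs_of_pos h] at hl; rw [abs_of_pos (by omega)]; omega
      · rw [abs_of_neg h] at hl; rw [abs_of_neg (by omega)]; omega
    have e1 := scan_append_cons hu (d := (x, k₁)) hl [] A [] []
    have e2 := scan_append_cons hu (d := (x, k₁ + k₂)) hl' [] A [] C
    simp only [List.nil_append] at e1 e2
    rw [e1, e2, exchange_of_lt u M hl]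
    simp
  · have r1 := norm_inv_scan_mul_scan_le hu [] A [] [(x, k₁)]
    have r2 := norm_inv_scan_mul_scan_le hu [] A [] ((x, k₁ + k₂) :: C)
    simp only [List.nil_append, List.length_nil, tsub_zero] at r1 r2
    generalize (exchange u M A.reverse (x, k₁) []).2 = k at h1 ⊢
    generalize sylEval (scan (exchange u M) [] A [(x, k₁)]) = a at r1 ⊢
    generalize sylEval (scan (exchange u M) [] A []) = b at r1 r2
    generalize sylEval (scan (exchange u M) [] A ((x, k₁ + k₂) :: C)) = c at r2 ⊢
    have e : (FreeGroup.of x ^ k)⁻¹ * a⁻¹ * c * FreeGroup.of x ^ k₁ =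
        (FreeGroup.of x ^ k)⁻¹ * ((b⁻¹ * a)⁻¹ * (b⁻¹ * c)) * FreeGroup.of x ^ k₁ := by group
    rw [e]
    have n0 := norm_mul₃_le (FreeGroup.of x ^ k)⁻¹ ((b⁻¹ * a)⁻¹ * (b⁻¹ * c)) (FreeGroup.of x ^ k₁)
    have n1 := norm_of_zpow_le x k
    have n2 := norm_of_zpow_le x k₁
    have n3 := FreeGroup.norm_mul_le (b⁻¹ * a)⁻¹ (b⁻¹ * c)
    rw [FreeGroup.norm_inv_eq] at n0 n3
    have := abs_le.1 (not_lt.1 hl)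
    simp only at h1
    omega

/-- The mirror image of `norm_inv_scan_mul_scan_le`. -/
theorem norm_scan_mul_inv_scan_le (hu : ∀ s ∈ u, |s.2| ≤ M) (P B : List (X × ℤ)) :
    (sylEval (scan (exchange u M) P B []) *
      (sylEval (scan (exchange u M) [] B []))⁻¹).norm ≤ u.length * (6 * M) := by
  have h := norm_inv_scan_mul_scan_le hu [] (B.map sylInv).reverse [] (P.map sylInv)
  rw [← FreeGroup.norm_inv_eq, sylEval_scan_eq_inv u M P, sylEval_scan_eq_inv u M []]
  simpa using h

/-- The mirror image of `norm_inv_scan_mul_scan_mul_le`. -/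
theorem norm_mul_scan_mul_inv_scan_le (hu : ∀ s ∈ u, |s.2| ≤ M) (P B : List (X × ℤ)) (x : X)
    {k₁ k₂ : ℤ} (hk : 0 < k₁ * k₂) :
    (FreeGroup.of x ^ k₂ * sylEval (scan (exchange u M) ((x, k₁ + k₂) :: P) B []) *
      (sylEval (scan (exchange u M) [] ((x, k₂) :: B) []))⁻¹).norm ≤
      2 * (u.length * (6 * M)) + 6 * M := by
  have h := norm_inv_scan_mul_scan_mul_le hu (B.map sylInv).reverse (P.map sylInv) x
    (k₁ := -k₂) (k₂ := -k₁) (by linarith)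
  rw [← FreeGroup.norm_inv_eq, sylEval_scan_eq_inv u M (_ :: _), sylEval_scan_eq_inv u M []]
  have e : -k₂ + -k₁ = -(k₁ + k₂) := by ring
  rw [e] at h
  simpa [sylInv, mul_assoc] using h

/-- The map of the free group that exchanges exponents by `tau M` in the syllable normal form, at all
places where the pattern `u` or its inverse occurs. -/
def exchangeMap (u : List (X × ℤ)) (M : ℕ) (g : FreeGroup X) : FreeGroup X :=
  sylEval (scan (exchange u M) [] (syl g) [])

theorem exchangeMap_sylEval (u : List (X × ℤ)) (M : ℕ) {L : List (X × ℤ)} (hL : IsSyl L) :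
    exchangeMap u M (sylEval L) = sylEval (scan (exchange u M) [] L []) := by
  rw [exchangeMap, syl_sylEval hL]

theorem exchangeMap_involutive (u : List (X × ℤ)) (M : ℕ) :
    Function.Involutive (exchangeMap u M) := fun g => by
  rw [exchangeMap.eq_def u M g, exchangeMap_sylEval u M (isSyl_scan_exchange u M (isSyl_syl g)),
    scan_scan u M (syl g) rfl rfl, sylEval_syl]

theorem exchangeMap_inv (u : List (X × ℤ)) (M : ℕ) (g : FreeGroup X) :
    exchangeMap u M g⁻¹ = (exchangeMap u M g)⁻¹ := by
  have h : g⁻¹ = sylEval ((syl g).map sylInv).reverse := by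
    rw [sylEval_reverse_map_sylInv, sylEval_syl]
  rw [h, exchangeMap_sylEval u M (isSyl_reverse_map_sylInv (isSyl_syl g)), exchangeMap,
    sylEval_scan_eq_inv u M []]
  simp

theorem finite_norm_le [Finite X] (r : ℕ) : {g : FreeGroup X | g.norm ≤ r}.Finite :=
  (List.finite_length_le (X × Bool) r).preimage FreeGroup.toWord_injective.injOn

theorem isQuasiUlam_exchangeMap [Finite X] (hu : ∀ s ∈ u, |s.2| ≤ M) :
    IsQuasiUlam (exchangeMap u M) := by
  -- The exceptional set is a ball in the word norm, and the error at the seam is put into `e₂`.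
  obtain ⟨r, hr⟩ : ∃ r, r = 2 * (2 * (u.length * (6 * M)) + 6 * M) + M := ⟨_, rfl⟩
  have h1 : (1 : FreeGroup X) ∈ (finite_norm_le (X := X) r).toFinset := by simp
  refine ⟨(finite_norm_le r).toFinset, fun w₁ w₂ hw => ?_, fun g =>
    ⟨1, h1, 1, h1, by simp [exchangeMap_inv]⟩⟩
  refine ⟨1, h1, (exchangeMap u M (FreeGroup.mk w₁))⁻¹ * exchangeMap u M (FreeGroup.mk (w₁ ++ w₂)) *
    (exchangeMap u M (FreeGroup.mk w₂))⁻¹, ?_, 1, h1, by group⟩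
  rw [Set.Finite.mem_toFinset, Set.mem_ofPred_eq, hr]
  rcases syl_mk_append hw with h | ⟨A, B, x, k₁, k₂, hk, e1, e2, e⟩
  · simp only [exchangeMap, h]
    rw [scan_append, sylEval_append, ← mul_assoc, mul_assoc (_ * _)]
    have r1 := norm_inv_scan_mul_scan_le hu [] (syl (FreeGroup.mk w₁)) [] (syl (FreeGroup.mk w₂))
    have r2 := norm_scan_mul_inv_scan_le hu (syl (FreeGroup.mk w₁)).reverse (syl (FreeGroup.mk w₂))
    refine (FreeGroup.norm_mul_le _ _).trans ?_
    simp only [List.nil_append, List.append_nil, List.length_nil, tsub_zero] at r1 r2 ⊢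
    omega
  · simp only [exchangeMap, e1, e2, e]
    have r1 := norm_inv_scan_mul_scan_mul_le hu A B x hk
    have r2 := norm_mul_scan_mul_inv_scan_le hu A.reverse B x hk
    have hs := scan_append (exchange u M) [] A ((x, k₁ + k₂) :: B) []
    rw [scan_cons, List.append_nil, List.append_nil, List.append_nil] at hs
    rw [hs, sylEval_append, sylEval_cons]
    have hx : (exchange u M A.reverse (x, k₁ + k₂) B).1 = x := rfl
    have h1 := abs_le.1 (abs_exchange_sub_le u M A.reverse (x, k₁ + k₂) B)
    rw [hx]
    generalize (exchange u M A.reverse (x, k₁ + k₂) B).2 = k at h1 ⊢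
    simp only at h1
    have n1 := norm_of_zpow_le x (-k₁ + k - k₂)
    generalize (sylEval (scan (exchange u M) [] (A ++ [(x, k₁)]) []))⁻¹ = a at *
    generalize (sylEval (scan (exchange u M) [] ((x, k₂) :: B) []))⁻¹ = b at *
    generalize sylEval (scan (exchange u M) [] A ((x, k₁ + k₂) :: B)) = c at *
    generalize sylEval (scan (exchange u M) ((x, k₁ + k₂) :: A.reverse) B []) = d at *
    have e' : a * (c * (FreeGroup.of x ^ k * d)) * b = (a * c * FreeGroup.of x ^ k₁) *
        FreeGroup.of x ^ (-k₁ + k - k₂) * (FreeGroup.of x ^ k₂ * d * b) := by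
      simp only [zpow_add, zpow_sub]; group
    rw [e']
    refine (norm_mul₃_le _ _ _).trans ?_
    omega

end quasiUlam

/-! ### Homogeneous quasimorphisms -/

section homogeneous

variable {G : Type*} [Group G]

theorem H_one (α : H G) : α.1 1 = 0 := by
  have := α.2.2 1 0
  simpa using this

/-- Homogeneous quasimorphisms are odd. -/
theorem H_inv (α : H G) (g : G) : α.1 g⁻¹ = -α.1 g := by
  obtain ⟨D, hD⟩ := α.2.1
  have hbdd : ∀ h : G, |α.1 h + α.1 h⁻¹| ≤ D := fun h => by
    have := hD h h⁻¹
    rw [mul_inv_cancel, H_one, zero_sub] at this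
    rwa [← abs_neg, show -(α.1 h + α.1 h⁻¹) = -α.1 h - α.1 h⁻¹ by ring]
  let β : G → ℝ := fun h => -α.1 h⁻¹
  have hd : IsBdd (β - α.1) := ⟨D, fun h => by
    rw [← abs_neg]
    simpa [β, add_comm] using hbdd h⟩
  have hβ : β ∈ H G := by
    refine ⟨?_, fun h n => ?_⟩
    · have := (Q G).add_mem hd.mem_Q α.2.1
      simpa using this
    · simp only [β, ← inv_pow, α.2.2]; ring
  have := congrFun (eq_of_isBdd_sub hβ α.2 hd) g
  simp only [β] at this
  linarith

/-- Homogeneous quasimorphisms are class functions. -/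
theorem H_conj (α : H G) {g h : G} (hgh : IsConj g h) : α.1 g = α.1 h := by
  obtain ⟨c, rfl⟩ := isConj_iff.1 hgh
  obtain ⟨D, hD⟩ := α.2.1
  let β : G → ℝ := fun g => α.1 (c * g * c⁻¹)
  have hd : IsBdd (β - α.1) := ⟨D + D, fun g => by
    have h1 := abs_le.1 (hD (c * g) c⁻¹)
    have h2 := abs_le.1 (hD c g)
    rw [H_inv] at h1
    simp only [β, Pi.sub_apply]
    rw [abs_le]
    constructor <;> linarith [h1.1, h1.2, h2.1, h2.2]⟩
  have hβ : β ∈ H G := by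
    refine ⟨?_, fun h n => ?_⟩
    · have := (Q G).add_mem hd.mem_Q α.2.1
      simpa using this
    · simp only [β, ← conj_pow, α.2.2]
  exact (congrFun (eq_of_isBdd_sub hβ α.2 hd) g).symm

theorem H_mul_comm (α : H G) (g h : G) : α.1 (g * h) = α.1 (h * g) :=
  H_conj α (isConj_iff.2 ⟨h, by group⟩)

theorem H_zpow (α : H G) (g : G) (k : ℤ) : α.1 (g ^ k) = k * α.1 g := by
  obtain ⟨n, rfl | rfl⟩ := Int.eq_nat_or_neg k
  · rw [zpow_natCast, α.2.2]; simp
  · rw [zpow_neg, zpow_natCast, H_inv, α.2.2]; push_cast; ring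

/-- A homogeneous quasimorphism is computed on `g` by the linear growth along the powers of `g` of
any function at bounded distance from it. -/
theorem H_eq_of_growth (β : H G) {b : G → ℝ} (hb : IsBdd (β.1 - b)) {g : G} {v C : ℝ}
    (h : ∀ j : ℕ, |b (g ^ (j + 2)) - j * v| ≤ C) : β.1 g = v := by
  obtain ⟨C', hC'⟩ := hb
  by_contra hne
  have hpos : 0 < |β.1 g - v| := abs_pos.2 (sub_ne_zero.2 hne)
  obtain ⟨n, hn⟩ := exists_nat_gt ((C + C' + 2 * |β.1 g|) / |β.1 g - v|)
  rw [div_lt_iff₀ hpos] at hn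
  have h1 := h n
  have h2 := hC' (g ^ (n + 2))
  rw [Pi.sub_apply, β.2.2] at h2
  have h3 : (n : ℝ) * |β.1 g - v| = |n * (β.1 g - v)| := by rw [abs_mul, Nat.abs_cast]
  have h4 : n * (β.1 g - v) = (((n + 2 : ℕ) : ℝ) * β.1 g - b (g ^ (n + 2))) +
      (b (g ^ (n + 2)) - n * v) + -(2 * β.1 g) := by push_cast; ring
  have h5 := abs_add_three (((n + 2 : ℕ) : ℝ) * β.1 g - b (g ^ (n + 2)))
    (b (g ^ (n + 2)) - n * v) (-(2 * β.1 g))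
  rw [← h4, ← h3, abs_neg, abs_mul, abs_two] at h5
  linarith

end homogeneous

/-! ### Homomorphisms to the reals -/

section hom

variable {X : Type*}

/-- The homomorphism from the free group to `ℝ` with prescribed values on the generators. -/
def homOf (c : X → ℝ) : H (FreeGroup X) :=
  ⟨fun g => Multiplicative.toAdd (FreeGroup.lift (fun x => Multiplicative.ofAdd (c x)) g),
    ⟨0, fun g h => by simp⟩, fun g n => by simp⟩

theorem homOf_mem (c : X → ℝ) : homOf c ∈ homSpace (FreeGroup X) := fun g h => by simp [homOf]

theorem homOf_of (c : X → ℝ) (x : X) : (homOf c).1 (FreeGroup.of x) = c x := by simp [homOf]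

/-- The total exponent sum. -/
def expSum (X : Type*) : H (FreeGroup X) := homOf fun _ => 1

theorem expSum_sylEval (L : List (X × ℤ)) :
    (expSum X).1 (sylEval L) = (L.map fun t => (t.2 : ℝ)).sum := by
  induction L with
  | nil => simpa using H_one (expSum X)
  | cons t L ih =>
    rw [expSum] at ih ⊢
    rw [sylEval_cons, homOf_mem, H_zpow, homOf_of, mul_one, List.map_cons, List.sum_cons, ← ih]

end hom

/-! ### Quasi-Ulam maps are quasimorphisms -/

section quasimorphism

variable {X : Type*}

/-- Two reduced words factor as `a * c` and `c⁻¹ * b`, where their product `a * b` is reduced. -/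
theorem exists_cancel (w₁ w₂ : List (X × Bool)) (h₁ : FreeGroup.IsReduced w₁)
    (h₂ : FreeGroup.IsReduced w₂) : ∃ a b c : List (X × Bool),
      w₁ = a ++ c ∧ w₂ = FreeGroup.invRev c ++ b ∧ FreeGroup.IsReduced (a ++ b) := by
  classical
  induction w₁ using List.reverseRecOn generalizing w₂ with
  | nil => exact ⟨[], w₂, [], by simp, by simp, by simpa using h₂⟩
  | append_singleton w l ih =>
    by_cases hl : ∃ w', w₂ = (l.1, !l.2) :: w'
    · obtain ⟨w', rfl⟩ := hl
      obtain ⟨a, b, c, e1, e2, e3⟩ := ih w' (h₁.infix (List.prefix_append _ _).isInfix)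
        (h₂.infix (List.suffix_cons _ _).isInfix)
      refine ⟨a, b, c ++ [l], by rw [e1, List.append_assoc], ?_, e3⟩
      rw [e2]; simp [FreeGroup.invRev]
    · refine ⟨w ++ [l], w₂, [], by simp, by simp, ?_⟩
      rw [FreeGroup.IsReduced, List.isChain_append]
      refine ⟨h₁, h₂, fun s hs t ht hst => ?_⟩
      obtain rfl : l = s := by simpa using hs
      cases w₂ with
      | nil => simp at ht
      | cons t' w' =>
        obtain rfl : t' = t := by simpa using ht
        by_contra hne
        refine hl ⟨w', ?_⟩
        congr 1
        ext
        · exact hst.symm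
        · revert hne
          cases l.2 <;> cases t'.2 <;> simp

theorem IsQuasiUlam.isQuasimorphism {G : Type*} [Group G] {f : FreeGroup X → G}
    (hf : IsQuasiUlam f) : IsQuasimorphism f := by
  classical
  obtain ⟨E, hE, hE'⟩ := hf
  rintro α ⟨D, hD⟩
  obtain ⟨C, hC⟩ : ∃ C, ∀ e ∈ E, |α e| ≤ C :=
    ⟨∑ e ∈ E, |α e|, fun e he =>
      Finset.single_le_sum (f := fun e => |α e|) (fun _ _ => abs_nonneg _) he⟩
  have hmul : ∀ w₁ w₂ : List (X × Bool), FreeGroup.IsReduced (w₁ ++ w₂) →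
      |α (f (FreeGroup.mk w₁ * FreeGroup.mk w₂)) - α (f (FreeGroup.mk w₁))
        - α (f (FreeGroup.mk w₂))| ≤ 4 * D + 3 * C := by
    intro w₁ w₂ hw
    obtain ⟨e₁, h₁, e₂, h₂, e₃, h₃, e⟩ := hE w₁ w₂ hw
    rw [FreeGroup.mul_mk, e]
    generalize f (FreeGroup.mk w₁) = x
    generalize f (FreeGroup.mk w₂) = y
    have a1 := abs_le.1 (hD (e₁ * x * e₂ * y) e₃)
    have a2 := abs_le.1 (hD (e₁ * x * e₂) y)
    have a3 := abs_le.1 (hD (e₁ * x) e₂)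
    have a4 := abs_le.1 (hD e₁ x)
    have b1 := abs_le.1 (hC e₁ h₁)
    have b2 := abs_le.1 (hC e₂ h₂)
    have b3 := abs_le.1 (hC e₃ h₃)
    rw [abs_le]
    constructor <;> linarith [a1.1, a1.2, a2.1, a2.2, a3.1, a3.2, a4.1, a4.2, b1.1, b1.2, b2.1,
      b2.2, b3.1, b3.2]
  have hinv : ∀ g, |α (f g⁻¹) + α (f g)| ≤ 3 * D + 2 * C + |α 1| := by
    intro g
    obtain ⟨e₁, h₁, e₂, h₂, e⟩ := hE' g
    rw [e]
    generalize f g = x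
    have a1 := abs_le.1 (hD (e₁ * x⁻¹) e₂)
    have a2 := abs_le.1 (hD e₁ x⁻¹)
    have a3 := abs_le.1 (hD x x⁻¹)
    rw [mul_inv_cancel] at a3
    have a4 := abs_le.1 (le_refl |α 1|)
    have b1 := abs_le.1 (hC e₁ h₁)
    have b2 := abs_le.1 (hC e₂ h₂)
    rw [abs_le]
    constructor <;> linarith [a1.1, a1.2, a2.1, a2.2, a3.1, a3.2, a4.1, a4.2, b1.1, b1.2, b2.1,
      b2.2]
  refine ⟨3 * (4 * D + 3 * C) + (3 * D + 2 * C + |α 1|), fun g h => ?_⟩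
  obtain ⟨a, b, c, e1, e2, e3⟩ := exists_cancel g.toWord h.toWord FreeGroup.isReduced_toWord
    FreeGroup.isReduced_toWord
  have i1 := abs_le.1 (hmul a c (e1 ▸ FreeGroup.isReduced_toWord))
  have i2 := abs_le.1 (hmul (FreeGroup.invRev c) b (e2 ▸ FreeGroup.isReduced_toWord))
  have i3 := abs_le.1 (hmul a b e3)
  have i4 := abs_le.1 (hinv (FreeGroup.mk c))
  rw [← FreeGroup.inv_mk] at i2
  have hg : g = FreeGroup.mk a * FreeGroup.mk c := by
    rw [FreeGroup.mul_mk, ← e1, FreeGroup.mk_toWord]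
  have hh : h = (FreeGroup.mk c)⁻¹ * FreeGroup.mk b := by
    rw [FreeGroup.inv_mk, FreeGroup.mul_mk, ← e2, FreeGroup.mk_toWord]
  have hgh : g * h = FreeGroup.mk a * FreeGroup.mk b := by rw [hg, hh]; group
  simp only [Function.comp_apply]
  rw [hgh, abs_le]
  rw [← hg] at i1
  rw [← hh] at i2
  constructor <;> linarith [i1.1, i1.2, i2.1, i2.2, i3.1, i3.2, i4.1, i4.2]

/-- An involutive quasi-Ulam map acts on a homogeneous quasimorphism by precomposition, up to
bounded functions. -/
theorem exists_mem_QOutQU {f : FreeGroup X → FreeGroup X} (hf : IsQuasiUlam f)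
    (hi : Function.Involutive f) :
    ∃ q ∈ QOutQU X, ∀ χ : H (FreeGroup X), IsBdd ((q • χ).1 - χ.1 ∘ f) := by
  have hq := hf.isQuasimorphism
  have hmul : QQ.mk f hq * QQ.mk f hq = 1 := by
    change QQ.mk (f ∘ f) (hq.comp hq) = QQ.mk id IsQuasimorphism.id
    congr 1
    exact hi.comp_self
  refine ⟨⟨QQ.mk f hq, QQ.mk f hq, hmul, hmul⟩, ?_, fun χ => ?_⟩
  · exact Subgroup.subset_closure ⟨f, hq, hi.bijective, hf, rfl⟩
  · exact homogenization_spec ⟨χ.1 ∘ f, hq _ χ.2.1⟩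

end quasimorphism

/-! ### Counting occurrences of cyclic words -/

section counting

variable {X : Type*}

theorem scan_sum_linear {S : Type*} {ι : Type*} (s : Finset ι) (c : ι → ℝ)
    (e : ι → List S → S → List S → ℝ) (A B C : List S) :
    (scan (fun A t B => ∑ i ∈ s, c i * e i A t B) A B C).sum =
      ∑ i ∈ s, c i * (scan (e i) A B C).sum := by
  induction B generalizing A with
  | nil => simp
  | cons t B ih => simp [ih, mul_add, Finset.sum_add_distrib]

theorem abs_scan_sum_le {S : Type*} {e : List S → S → List S → ℝ} {K : ℝ}
    (h : ∀ A t B, |e A t B| ≤ K) (A B C : List S) : |(scan e A B C).sum| ≤ B.length * K := by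
  induction B generalizing A with
  | nil => simp
  | cons t B ih =>
    rw [scan_cons, List.sum_cons, List.length_cons]
    refine (abs_add_le _ _).trans ?_
    push_cast
    linarith [h A t (B ++ C), ih (t :: A)]

theorem scan_const_sum {S : Type*} (v : ℝ) (A B C : List S) :
    (scan (fun _ _ _ => v) A B C).sum = B.length * v := by
  induction B generalizing A with
  | nil => simp
  | cons t B ih => simp [ih]; ring

theorem scan_map_sum_sub (e : List (X × ℤ) → X × ℤ → List (X × ℤ) → X × ℤ)
    (A B C : List (X × ℤ)) :
    ((scan e A B C).map fun t => (t.2 : ℝ)).sum - (B.map fun t => (t.2 : ℝ)).sum =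
      (scan (fun A t B => ((e A t B).2 - t.2 : ℝ)) A B C).sum := by
  induction B generalizing A with
  | nil => simp
  | cons t B ih =>
    simp only [scan_cons, List.map_cons, List.sum_cons, ← ih]
    ring

theorem IsSyl.infix {L L' : List (X × ℤ)} (h : IsSyl L') (hL : L <:+: L') : IsSyl L :=
  ⟨fun t ht => h.1 t (hL.subset ht), h.2.infix hL⟩

/-- The cyclically reduced lists of `N` syllables with exponents of absolute value at most `M`. -/
def cyclicWords (X : Type*) (N M : ℕ) : Set (List (X × ℤ)) :=
  {u | u.length = N ∧ IsSyl (u ++ u) ∧ ∀ s ∈ u, |s.2| ≤ M}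

theorem finite_cyclicWords [Finite X] (N M : ℕ) : (cyclicWords X N M).Finite := by
  have h1 : {k : ℤ | |k| ≤ M}.Finite := by
    refine (Set.finite_Icc (-(M : ℤ)) M).subset fun k hk => ?_
    exact abs_le.1 hk
  have := h1.to_subtype
  refine ((List.finite_length_eq (X × {k : ℤ | |k| ≤ M}) N).image
    (List.map fun t => (t.1, (t.2 : ℤ)))).subset ?_
  rintro u ⟨hN, -, hM⟩
  refine ⟨u.attach.map fun t => (t.1.1, ⟨t.1.2, hM t.1 t.2⟩), by simpa using hN, ?_⟩
  rw [List.map_map]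
  exact List.attach_map_subtype_val u

theorem isSyl_flatten_append {w : List (X × ℤ)} (hw : IsSyl (w ++ w)) (j : ℕ) :
    IsSyl ((List.replicate j w).flatten ++ w) := by
  induction j with
  | zero => simpa using (isSyl_append.1 hw).1
  | succ j ih =>
    rw [List.replicate_succ, List.flatten_cons, List.append_assoc, isSyl_append]
    refine ⟨(isSyl_append.1 hw).1, ih, ?_⟩
    have h : ((List.replicate j w).flatten ++ w).head? = w.head? := by
      cases j with
      | zero => simp
      | succ j =>
        cases w with
        | nil => simp
        | cons t w => simp [List.replicate_succ]
    rw [h]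
    exact (isSyl_append.1 hw).2.2

theorem flatten_replicate_append (w : List (X × ℤ)) (j : ℕ) :
    (List.replicate j w).flatten ++ w = w ++ (List.replicate j w).flatten := by
  rw [← List.flatten_cons, ← List.replicate_succ, List.replicate_succ', List.flatten_append]
  simp

theorem isSyl_flatten {w : List (X × ℤ)} (hw : IsSyl (w ++ w)) (j : ℕ) :
    IsSyl (List.replicate j w).flatten :=
  (isSyl_append.1 (isSyl_flatten_append hw j)).1

theorem sylEval_flatten (w : List (X × ℤ)) (j : ℕ) :
    sylEval (List.replicate j w).flatten = sylEval w ^ j := by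
  induction j with
  | zero => simp
  | succ j ih => rw [List.replicate_succ, List.flatten_cons, sylEval_append, ih, pow_succ']

theorem rotate_mem_cyclicWords {N M : ℕ} {a b : List (X × ℤ)}
    (h : a ++ b ∈ cyclicWords X N M) : b ++ a ∈ cyclicWords X N M := by
  obtain ⟨h1, h2, h3⟩ := h
  refine ⟨by simpa [add_comm] using h1, ?_, fun s hs => h3 s (by simpa [or_comm] using hs)⟩
  refine (isSyl_flatten_append h2 2).infix ⟨a, b, ?_⟩
  simp [List.replicate_succ]

theorem inv_mem_cyclicWords {N M : ℕ} {w : List (X × ℤ)} (h : w ∈ cyclicWords X N M) :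
    (w.map sylInv).reverse ∈ cyclicWords X N M := by
  obtain ⟨h1, h2, h3⟩ := h
  refine ⟨by simpa using h1, ?_, ?_⟩
  · have := isSyl_reverse_map_sylInv h2
    rwa [List.map_append, List.reverse_append] at this
  · intro s hs
    obtain ⟨t, ht, rfl⟩ := List.mem_map.1 (List.mem_reverse.1 hs)
    simpa [sylInv] using h3 t ht

theorem prefix_map_sylMin_iff {N M : ℕ} {u l : List (X × ℤ)} (hu : u.length = N)
    (hl : ∀ s ∈ l.take N, |s.2| ≤ M) : u <+: l.map (sylMin M) ↔ u = l.take N := by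
  have h : (l.map (sylMin M)).take N = l.take N := by
    rw [← List.map_take]
    refine (List.map_congr_left fun s hs => ?_).trans (List.map_id _)
    simp [sylMin, tauMin_of_le (hl s hs)]
  rw [List.prefix_iff_eq_take, hu, h]

/-- The sign of the first exponent of a list of syllables. -/
def headSign (u : List (X × ℤ)) : ℤ := (u.head?.map fun t => t.2.sign).getD 0

/-- The change of the exponent of a syllable under the exchange map with pattern `u`. -/
def shift (u : List (X × ℤ)) (M : ℕ) (A : List (X × ℤ)) (t : X × ℤ) (B : List (X × ℤ)) : ℝ :=
  ((exchange u M A t B).2 - t.2 : ℝ)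

theorem abs_shift_le (u : List (X × ℤ)) (M : ℕ) (A : List (X × ℤ)) (t : X × ℤ)
    (B : List (X × ℤ)) : |shift u M A t B| ≤ M := by
  have h := abs_exchange_sub_le u M A t B
  rw [shift]
  exact_mod_cast h

variable {N M : ℕ} {W : Finset (List (X × ℤ))}

/-- The weighted sum, over all patterns of `N` syllables, of the shifts at a syllable `t`: only the
patterns read off to the right of `t` and, inverted, to the left of `t` contribute. -/
theorem sum_shift (hN : 1 ≤ N) (hW : ∀ u, u ∈ W ↔ u ∈ cyclicWords X N M)
    (a : List (X × ℤ) → ℝ) {A B p q : List (X × ℤ)} {t : X × ℤ}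
    (hp : (t :: B).take N = p) (hq : ((t :: A).map sylInv).take N = q) (hpW : p ∈ W)
    (hqW : q ∈ W) :
    ∑ u ∈ W, a u * headSign u * shift u M A t B = M * (a p - a q) := by
  classical
  obtain ⟨m, rfl⟩ := Nat.exists_eq_succ_of_ne_zero (Nat.one_le_iff_ne_zero.1 hN)
  have hpM := ((hW p).1 hpW).2.2
  have hqM := ((hW q).1 hqW).2.2
  have htp : t ∈ p := by rw [← hp]; simp
  have htM : |t.2| ≤ M := hpM t htp
  have ht0 : t.2 ≠ 0 := (isSyl_append.1 ((hW p).1 hpW).2.1).1.1 t htp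
  have hsp : headSign p = t.2.sign := by rw [← hp]; simp [headSign]
  have hsq : headSign q = -t.2.sign := by rw [← hq]; simp [headSign, sylInv]
  have hpq : p ≠ q := by
    rintro rfl
    have hs0 : t.2.sign ≠ 0 := by rwa [Ne, Int.sign_eq_zero_iff_zero]
    omega
  have hss : (t.2.sign : ℝ) * t.2.sign = 1 := by
    have : t.2.sign * t.2.sign = 1 := by
      rcases lt_or_gt_of_ne ht0 with h | h
      · rw [Int.sign_eq_neg_one_of_neg h]; rfl
      · rw [Int.sign_eq_one_of_pos h]; rfl
    exact_mod_cast this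
  have key : ∀ u ∈ W, a u * headSign u * shift u M A t B =
      (if u = p then M * a p else 0) + (if u = q then -(M * a q) else 0) := by
    intro u hu
    have hO : Occurs u M A t B ↔ u = p ∨ u = q := by
      rw [Occurs, prefix_map_sylMin_iff ((hW u).1 hu).1 (by rwa [hp]),
        prefix_map_sylMin_iff ((hW u).1 hu).1 (by rwa [hq]), hp, hq]
    by_cases h : Occurs u M A t B
    · have hsh : shift u M A t B = M * t.2.sign := by
        rw [shift, exchange, if_pos h, tau_of_le htM]; push_cast; ring
      rw [hsh]
      rcases hO.1 h with rfl | rfl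
      · rw [if_pos rfl, if_neg hpq, hsp]
        linear_combination (a u * M) * hss
      · rw [if_pos rfl, if_neg hpq.symm, hsq]
        push_cast
        linear_combination (-a u * M) * hss
    · have hsh : shift u M A t B = 0 := by rw [shift, exchange, if_neg h]; simp
      rw [hO, not_or] at h
      rw [hsh, if_neg h.1, if_neg h.2]; simp
  rw [Finset.sum_congr rfl key, Finset.sum_add_distrib, Finset.sum_ite_eq', Finset.sum_ite_eq',
    if_pos hpW, if_pos hqW]
  ring

/-- Within a power of a cyclic word `w`, the weighted sum of the shifts over one copy of `w`: the
patterns seen by its syllables are precisely the rotations of `w` and of its inverse, and there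
are `N` of each. -/
theorem scan_sum_shift (hN : 1 ≤ N) (hW : ∀ u, u ∈ W ↔ u ∈ cyclicWords X N M)
    (α : H (FreeGroup X)) {w : List (X × ℤ)} (hw : w ∈ W) (A C : List (X × ℤ)) :
    (scan (fun A t B => ∑ u ∈ W, α.1 (sylEval u) * headSign u * shift u M A t B)
      (w.reverse ++ A) w (w ++ C)).sum = N * (2 * M * α.1 (sylEval w)) := by
  rw [scan_congr _ (A' := []) (C' := [])
    (e' := fun _ _ _ => (2 * M * α.1 (sylEval w) : ℝ)) w, scan_const_sum, ((hW w).1 hw).1]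
  rintro a t b rfl
  have hlen := ((hW _).1 hw).1
  simp only [List.length_append, List.length_cons] at hlen
  have hp : (t :: (b ++ ((a ++ t :: b) ++ C))).take N = (t :: b) ++ a := by
    have : t :: (b ++ ((a ++ t :: b) ++ C)) = ((t :: b) ++ a) ++ (t :: b ++ C) := by simp
    rw [this]
    exact List.take_left' (by simp; omega)
  have hq : ((t :: (a.reverse ++ ((a ++ t :: b).reverse ++ A))).map sylInv).take N =
      ((b ++ (a ++ [t])).map sylInv).reverse := by
    have : (t :: (a.reverse ++ ((a ++ t :: b).reverse ++ A))).map sylInv =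
        ((b ++ (a ++ [t])).map sylInv).reverse ++ (t :: (a.reverse ++ A)).map sylInv := by simp
    rw [this]
    exact List.take_left' (by simp; omega)
  have e : a ++ t :: b = (a ++ [t]) ++ b := by simp
  have hpW : (t :: b) ++ a ∈ W := (hW _).2 (rotate_mem_cyclicWords ((hW _).1 hw))
  have hqW : ((b ++ (a ++ [t])).map sylInv).reverse ∈ W :=
    (hW _).2 (inv_mem_cyclicWords (rotate_mem_cyclicWords (e ▸ (hW _).1 hw)))
  refine (sum_shift hN hW (fun u => α.1 (sylEval u)) hp hq hpW hqW).trans ?_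
  rw [sylEval_reverse_map_sylInv, H_inv, sylEval_append, H_mul_comm, ← sylEval_append,
    sylEval_append b, H_mul_comm α (sylEval b), ← sylEval_append, ← e]
  ring

variable [DecidableEq X]

/-- The linear combination, with coefficients given by `α`, of the changes of the total exponent sum
under all exchange maps grows along the powers of a cyclic word `w` at the rate
`2 * N * M * α w`. -/
theorem exists_abs_sum_exchangeMap_sub_le (hN : 1 ≤ N) (hW : ∀ u, u ∈ W ↔ u ∈ cyclicWords X N M)
    (α : H (FreeGroup X)) {w : List (X × ℤ)} (hw : w ∈ W) : ∃ C : ℝ, ∀ j : ℕ,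
    |∑ u ∈ W, α.1 (sylEval u) * headSign u *
        ((expSum X).1 (exchangeMap u M (sylEval w ^ (j + 2))) -
          (expSum X).1 (sylEval w ^ (j + 2))) -
      j * (N * (2 * M * α.1 (sylEval w)))| ≤ C := by
  set h : List (X × ℤ) → X × ℤ → List (X × ℤ) → ℝ :=
    fun A t B => ∑ u ∈ W, α.1 (sylEval u) * headSign u * shift u M A t B with hh
  obtain ⟨K, hK⟩ : ∃ K, ∀ A t B, |h A t B| ≤ K := by
    refine ⟨∑ u ∈ W, |α.1 (sylEval u) * headSign u| * M, fun A t B => ?_⟩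
    refine (Finset.abs_sum_le_sum_abs _ _).trans (Finset.sum_le_sum fun u _ => ?_)
    rw [abs_mul]
    exact mul_le_mul_of_nonneg_left (abs_shift_le u M A t B) (abs_nonneg _)
  refine ⟨2 * (w.length * K), fun j => ?_⟩
  have hw2 := ((hW w).1 hw).2.1
  have hsum : ∑ u ∈ W, α.1 (sylEval u) * headSign u *
        ((expSum X).1 (exchangeMap u M (sylEval w ^ (j + 2))) -
          (expSum X).1 (sylEval w ^ (j + 2))) =
      (scan h [] (List.replicate (j + 2) w).flatten []).sum := by
    rw [hh, scan_sum_linear]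
    refine Finset.sum_congr rfl fun u _ => ?_
    rw [← sylEval_flatten, exchangeMap_sylEval u M (isSyl_flatten hw2 _), expSum_sylEval,
      expSum_sylEval, scan_map_sum_sub]
    rfl
  -- All copies of `w` but the first and the last have a copy of `w` on either side.
  have hmid : ∀ (j : ℕ) (A : List (X × ℤ)),
      (scan h (w.reverse ++ A) (List.replicate j w).flatten w).sum =
        j * (N * (2 * M * α.1 (sylEval w))) := by
    intro j
    induction j with
    | zero => simp
    | succ j ih =>
      intro A
      rw [List.replicate_succ, List.flatten_cons, scan_append, List.sum_append, ih,
        flatten_replicate_append, hh, scan_sum_shift hN hW α hw]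
      push_cast; ring
  have hsplit : (List.replicate (j + 2) w).flatten = w ++ ((List.replicate j w).flatten ++ w) := by
    rw [flatten_replicate_append, List.replicate_succ, List.replicate_succ]; rfl
  rw [hsum, hsplit, scan_append, List.sum_append, scan_append, List.sum_append, List.append_nil w,
    hmid]
  have b1 := abs_le.1 (abs_scan_sum_le hK [] w ((List.replicate j w).flatten ++ w ++ []))
  have b2 := abs_le.1 (abs_scan_sum_le hK
    ((List.replicate j w).flatten.reverse ++ (w.reverse ++ [])) w [])
  rw [abs_le]
  constructor <;> linarith [b1.1, b1.2, b2.1, b2.2]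

theorem exchangeMap_of_zpow {u : List (X × ℤ)} (hu : 2 ≤ u.length) (M : ℕ) (x : X) (k : ℤ) :
    exchangeMap u M (FreeGroup.of x ^ k) = FreeGroup.of x ^ k := by
  by_cases hk : k = 0
  · have h := exchangeMap_sylEval u M (L := []) ⟨by simp, by simp⟩
    subst hk
    simpa using h
  · have h := exchangeMap_sylEval u M (L := [(x, k)]) ⟨by simpa using hk, by simp⟩
    have hO : ¬ Occurs u M [] (x, k) [] := by
      rintro (h | h) <;>
      · have := h.length_le
        simp at this
        omega
    simpa [exchange, hO] using h

end counting

/-! ### Density of the orbit of the homomorphisms -/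

section density

variable {X : Type*}

/-- The linear span of the orbit of the homomorphisms under the group generated by bijective
quasi-Ulam quasimorphisms. -/
def orbitSpan (X : Type*) : Submodule ℝ (H (FreeGroup X)) :=
  Submodule.span ℝ {β | ∃ q ∈ QOutQU X, ∃ χ ∈ homSpace (FreeGroup X), β = q • χ}

theorem smul_mem_orbitSpan {q : QOut (FreeGroup X)} (hq : q ∈ QOutQU X) {χ : H (FreeGroup X)}
    (hχ : χ ∈ homSpace (FreeGroup X)) : q • χ ∈ orbitSpan X :=
  Submodule.subset_span ⟨q, hq, χ, hχ, rfl⟩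

theorem homOf_mem_orbitSpan (c : X → ℝ) : homOf c ∈ orbitSpan X := by
  simpa using smul_mem_orbitSpan (one_mem _) (homOf_mem c)

variable [DecidableEq X]

theorem exists_mem_orbitSpan [Finite X] {u : List (X × ℤ)} {M : ℕ} (hu : ∀ s ∈ u, |s.2| ≤ M) :
    ∃ ψ ∈ orbitSpan X, IsBdd (ψ.1 - fun g => (expSum X).1 (exchangeMap u M g) - (expSum X).1 g) := by
  obtain ⟨q, hq, h⟩ := exists_mem_QOutQU (isQuasiUlam_exchangeMap hu) (exchangeMap_involutive u M)
  refine ⟨q • expSum X - expSum X,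
    sub_mem (smul_mem_orbitSpan hq (homOf_mem _)) (homOf_mem_orbitSpan _), ?_⟩
  convert h (expSum X) using 1
  ext g
  simp

/-- On all cyclic words with `N` syllables and exponents bounded by `M`, a homogeneous
quasimorphism agrees with an element of the span that vanishes on the generators. -/
theorem exists_eq_on_cyclicWords [Finite X] {N M : ℕ} (hN : 2 ≤ N) (hM : 1 ≤ M)
    (α : H (FreeGroup X)) :
    ∃ s ∈ orbitSpan X, (∀ w ∈ cyclicWords X N M, s.1 (sylEval w) = α.1 (sylEval w)) ∧
      ∀ x, s.1 (FreeGroup.of x) = 0 := by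
  set W := (finite_cyclicWords (X := X) N M).toFinset with hWdef
  have hW : ∀ u, u ∈ W ↔ u ∈ cyclicWords X N M := fun u => Set.Finite.mem_toFinset _
  have hex : ∀ u : List (X × ℤ), ∃ ψ ∈ orbitSpan X, u ∈ W →
      IsBdd (ψ.1 - fun g => (expSum X).1 (exchangeMap u M g) - (expSum X).1 g) := by
    intro u
    by_cases hu : u ∈ W
    · obtain ⟨ψ, h1, h2⟩ := exists_mem_orbitSpan ((hW u).1 hu).2.2
      exact ⟨ψ, h1, fun _ => h2⟩
    · exact ⟨0, zero_mem _, fun h => absurd h hu⟩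
  choose ψ hψ hbdd using hex
  choose! K hK using hbdd
  let c : List (X × ℤ) → ℝ := fun u => α.1 (sylEval u) * headSign u
  let s₀ : H (FreeGroup X) := ∑ u ∈ W, c u • ψ u
  let b : FreeGroup X → ℝ := fun g =>
    ∑ u ∈ W, c u * ((expSum X).1 (exchangeMap u M g) - (expSum X).1 g)
  have hs₀ : ∀ g, s₀.1 g = ∑ u ∈ W, c u * (ψ u).1 g := fun g => by
    simp [s₀, Finset.sum_apply]
  have hs : IsBdd (s₀.1 - b) := by
    refine ⟨∑ u ∈ W, |c u| * K u, fun g => ?_⟩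
    rw [Pi.sub_apply, hs₀, ← Finset.sum_sub_distrib]
    refine (Finset.abs_sum_le_sum_abs _ _).trans (Finset.sum_le_sum fun u hu => ?_)
    rw [← mul_sub, abs_mul]
    exact mul_le_mul_of_nonneg_left (hK u hu g) (abs_nonneg _)
  have hN0 : (N : ℝ) ≠ 0 := by
    have : N ≠ 0 := by omega
    exact_mod_cast this
  have hM0 : (M : ℝ) ≠ 0 := by
    have : M ≠ 0 := by omega
    exact_mod_cast this
  refine ⟨(1 / (2 * N * M : ℝ)) • s₀, Submodule.smul_mem _ _
    (Submodule.sum_mem _ fun u _ => Submodule.smul_mem _ _ (hψ u)), fun w hw => ?_, fun x => ?_⟩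
  · obtain ⟨C, hC⟩ := exists_abs_sum_exchangeMap_sub_le (by omega) hW α ((hW w).2 hw)
    have h := H_eq_of_growth s₀ hs hC
    change 1 / (2 * N * M : ℝ) * s₀.1 (sylEval w) = _
    rw [h]
    field_simp
  · have h : s₀.1 (FreeGroup.of x) = 0 := by
      refine H_eq_of_growth s₀ hs (C := 0) fun j => ?_
      have : b (FreeGroup.of x ^ (j + 2)) = 0 := by
        refine Finset.sum_eq_zero fun u hu => ?_
        rw [← zpow_natCast, exchangeMap_of_zpow (by rw [((hW u).1 hu).1]; exact hN), sub_self,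
          mul_zero]
      rw [this]; simp
    change 1 / (2 * N * M : ℝ) * s₀.1 (FreeGroup.of x) = _
    rw [h, mul_zero]

/-- Up to conjugation, every nontrivial element of a free group is a power of a generator or is
given by a cyclically reduced list of at least two syllables. -/
theorem exists_conj (g : FreeGroup X) : (∃ (x : X) (k : ℤ), IsConj g (FreeGroup.of x ^ k)) ∨
    g = 1 ∨ ∃ L : List (X × ℤ), 2 ≤ L.length ∧ IsSyl (L ++ L) ∧ IsConj g (sylEval L) := by
  obtain ⟨n, hn⟩ : ∃ n, n = (syl g).length := ⟨_, rfl⟩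
  induction n using Nat.strong_induction_on generalizing g with
  | _ n ih =>
  have hg := sylEval_syl g
  have hS := isSyl_syl g
  generalize syl g = S at hn hg hS
  subst hg
  cases S with
  | nil => exact Or.inr (Or.inl rfl)
  | cons t S =>
    induction S using List.reverseRecOn with
    | nil => exact Or.inl ⟨t.1, t.2, by simpa using IsConj.refl (FreeGroup.of t.1 ^ t.2)⟩
    | append_singleton A s _ =>
      obtain ⟨x, k⟩ := t
      obtain ⟨y, l⟩ := s
      by_cases hxy : y = x
      · subst hxy
        have h1 := isSyl_cons.1 hS
        have h2 := isSyl_append.1 h1.2.2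
        -- The last syllable is conjugated to the front, where it merges with the first one.
        have hconj : ∀ B : List (X × ℤ), sylEval B = sylEval ((y, l + k) :: A) →
            IsConj (sylEval ((y, k) :: (A ++ [(y, l)]))) (sylEval B) := by
          intro B hB
          rw [hB, isConj_iff]
          refine ⟨FreeGroup.of y ^ l, ?_⟩
          simp only [sylEval_cons, sylEval_append, sylEval_nil, zpow_add]
          group
        have hred : ∀ B : List (X × ℤ), IsSyl B → B.length < n →
            sylEval B = sylEval ((y, l + k) :: A) →
            (∃ (x : X) (k' : ℤ), IsConj (sylEval ((y, k) :: (A ++ [(y, l)])))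
              (FreeGroup.of x ^ k')) ∨ sylEval ((y, k) :: (A ++ [(y, l)])) = 1 ∨
            ∃ L : List (X × ℤ), 2 ≤ L.length ∧ IsSyl (L ++ L) ∧
              IsConj (sylEval ((y, k) :: (A ++ [(y, l)]))) (sylEval L) := by
          intro B hB hlen heq
          have hc := hconj B heq
          rcases ih B.length hlen (sylEval B) (by rw [syl_sylEval hB]) with
            ⟨x, k', h⟩ | h | ⟨L, h, h', h''⟩
          · exact Or.inl ⟨x, k', hc.trans h⟩
          · rw [h] at hc
            exact Or.inr (Or.inl (isConj_one_right.1 hc.symm))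
          · exact Or.inr (Or.inr ⟨L, h, h', hc.trans h''⟩)
        have hhead : ∀ s ∈ A.head?, y ≠ s.1 := by
          intro s hs
          exact h1.2.1 s (by rw [List.head?_append, hs]; rfl)
        by_cases hkl : l + k = 0
        · exact hred A h2.1 (by rw [hn]; simp) (by simp [hkl])
        · exact hred ((y, l + k) :: A) (isSyl_cons.2 ⟨hkl, hhead, h2.1⟩) (by rw [hn]; simp) rfl
      · refine Or.inr (Or.inr ⟨(x, k) :: (A ++ [(y, l)]), by simp, ?_, IsConj.refl _⟩)
        refine isSyl_append.2 ⟨hS, hS, ?_⟩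
        have e : ((x, k) :: (A ++ [(y, l)])).getLast? = some (y, l) := by
          rw [← List.cons_append]; exact List.getLast?_concat
        rw [e]
        simpa using hxy

/-- For a suitable `n`, and all multiples `N` of `n` and all large `M`, every element is
accounted for by the generators and the cyclic words with `N` syllables and exponents bounded by
`M`. -/
theorem exists_detected (g : FreeGroup X) : ∃ n M₀ : ℕ, n ≠ 0 ∧ ∀ N M : ℕ, n ∣ N → N ≠ 0 →
    M₀ ≤ M → ∀ α : H (FreeGroup X), (∀ x, α.1 (FreeGroup.of x) = 0) →
    (∀ w ∈ cyclicWords X N M, α.1 (sylEval w) = 0) → α.1 g = 0 := by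
  rcases exists_conj g with ⟨x, k, h⟩ | rfl | ⟨L, h2, hL, hc⟩
  · exact ⟨1, 0, one_ne_zero, fun N M _ _ _ α hα _ => by rw [H_conj α h, H_zpow, hα, mul_zero]⟩
  · exact ⟨1, 0, one_ne_zero, fun N M _ _ _ α _ _ => H_one α⟩
  · refine ⟨L.length, (L.map fun t => t.2.natAbs).sum, by omega, ?_⟩
    rintro N M ⟨j, rfl⟩ hN hM α - hα
    have hw : (List.replicate j L).flatten ∈ cyclicWords X (L.length * j) M := by
      refine ⟨by simp [mul_comm], ?_, fun s hs => ?_⟩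
      · have := isSyl_flatten hL (j + j)
        rwa [List.replicate_add, List.flatten_append] at this
      · obtain ⟨l, hl, hsl⟩ := List.mem_flatten.1 hs
        obtain rfl := List.eq_of_mem_replicate hl
        have h1 : s.2.natAbs ≤ (l.map fun t => t.2.natAbs).sum :=
          List.le_sum_of_mem (List.mem_map_of_mem hsl)
        rw [Int.abs_eq_natAbs]
        omega
    have h := hα _ hw
    rw [sylEval_flatten, α.2.2] at h
    have hj : (j : ℝ) ≠ 0 := by
      have : j ≠ 0 := by rintro rfl; simp at hN
      exact_mod_cast this
    rw [H_conj α hc]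
    exact (mul_eq_zero.1 h).resolve_left hj

/-- Every homogeneous quasimorphism agrees with an element of the span on any finite set. -/
theorem exists_eqOn_finset [Finite X] (α : H (FreeGroup X)) (I : Finset (FreeGroup X)) :
    ∃ s ∈ orbitSpan X, ∀ g ∈ I, s.1 g = α.1 g := by
  choose n M₀ hn h using exists_detected (X := X)
  let χ : H (FreeGroup X) := homOf fun x => α.1 (FreeGroup.of x)
  have hprod : ∏ g ∈ I, n g ≠ 0 := Finset.prod_ne_zero_iff.2 fun g _ => hn g
  obtain ⟨s, hs, hsW, hsx⟩ := exists_eq_on_cyclicWords (N := 2 * ∏ g ∈ I, n g)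
    (M := 1 + ∑ g ∈ I, M₀ g) (by omega) (by omega) (α - χ)
  refine ⟨s + χ, add_mem hs (homOf_mem_orbitSpan _), fun g hg => ?_⟩
  have := h g _ (1 + ∑ g ∈ I, M₀ g) ((Finset.dvd_prod_of_mem n hg).mul_left 2) (by omega)
    ((Finset.single_le_sum (f := M₀) (fun _ _ => Nat.zero_le _) hg).trans (Nat.le_add_left _ _))
    (s + χ - α) (fun x => ?_) (fun w hw => ?_)
  · have h' : (s + χ - α).1 g = (s + χ).1 g - α.1 g := rfl
    rw [h'] at this
    linarith
  · change s.1 _ + χ.1 _ - α.1 _ = 0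
    rw [hsx, homOf_of]; ring
  · change s.1 _ + χ.1 _ - α.1 _ = 0
    rw [hsW w hw]
    change α.1 _ - χ.1 _ + χ.1 _ - α.1 _ = 0
    ring

end density

end QuasiOut
end

theorem theorem6 (n : ℕ) (hn : 1 ≤ n) :
    closure ((Submodule.span ℝ {β : QuasiOut.H (FreeGroup (Fin n)) |
        ∃ q ∈ QuasiOut.QOutQU (Fin n), ∃ χ ∈ QuasiOut.homSpace (FreeGroup (Fin n)),
          β = q • χ} : Submodule ℝ (QuasiOut.H (FreeGroup (Fin n)))) :
      Set (QuasiOut.H (FreeGroup (Fin n)))) = Set.univ := by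
  refine Set.eq_univ_of_forall fun α => mem_closure_iff.2 fun o ho hα => ?_
  obtain ⟨V, hV, rfl⟩ := isOpen_induced_iff.1 ho
  obtain ⟨I, v, hv, hsub⟩ := isOpen_pi_iff.1 hV α.1 hα
  obtain ⟨s, hs, hsI⟩ := QuasiOut.exists_eqOn_finset α I
  refine ⟨s, hsub fun g hg => ?_, hs⟩
  rw [hsI g hg]
  exact (hv g hg).2
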